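/- Let $A\in\mathbb R^{m\times N}$ ($N\ge 3$) have columns $A_{\bullet 1},\dots,A_{\bullet N}$ of Euclidean norm $1$. For an index set $\mathcal J$ let $A_{\bullet\mathcal J}$ be the submatrix of columns indexed by $\mathcal J$; write $\vartheta_{ij}=\langle A_{\bullet i},A_{\bullet j}\rangle$, $a_+=\max(a,0)$ (entrywise for vectors), $\mathbb R^n_{+}$ and $\mathbb R^n_{++}$ for the vectors with nonnegative, respectively positive, entries, and $\operatorname{supp}(x)=\{i: x_i\neq 0\}$. Maxima and $\infty$-norms over an empty index set are $0$. Constrained matching pursuit on $\mathbb R^N_+$ with input $y\in\mathbb R^m$ starts from $x^0=0$, $\mathcal J_0=\emptyset$ and for $k=0,1,2,\dots$ chooses $$j^*_{k+1}\in\operatorname*{Argmin}_{1\le j\le N} g^*_j,\qquad g^*_j=\min\{\|y-A(x^k+t\mathbf e_j)\|_2^2 : t\in\mathbb R,\ x^k+t\mathbf e_j\in\mathbb R^N_+\},$$ sets $\mathcal J_{k+1}=\mathcal J_k\cup\{j^*_{k+1}\}$ and chooses $$x^{k+1}\in\operatorname*{Argmin}\{\|Aw-y\|_2^2 : w\in\mathbb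 R^N_+,\ \operatorname{supp}(w)\subseteq\mathcal J_{k+1}\}.$$ A vector $z\in\mathbb R^N_+$ is recovered from $y=Az$ if along every sequence $(x^k,j^*_k,\mathcal J_k)_{k}$ that can be generated in this way there is an $s$ with $\mathcal J_s=\operatorname{supp}(z)$, and for every $s$ with $\mathcal J_s=\operatorname{supp}(z)$ the problem $\min\{\|Aw-y\|_2^2: w\in\mathbb R^N_+,\ \operatorname{supp}(w)\subseteq\mathcal J_s\}$ has the unique solution $x^s=z$. Let $\mathcal S=\{1,2,3\}$, $\mathcal S^c=\{4,\dots,N\}$, $M=A_{\bullet\mathcal S}^TA_{\bullet\mathcal S}$, and for $\mathcal J\subset\mathcal S$, $\mathcal I=\mathcal S\setminus\mathcal J$, let $M/M_{\mathcal J\mathcal J}=M_{\mathcal I\mathcal I}-M_{\mathcal I\mathcal J}M_{\mathcal J\mathcal J}^{-1}M_{\mathcal J\mathcal I}$ be the Schur complement. Put $\Delta_{12}=\vartheta_{12}-\vartheta_{13}\vartheta_{23}$, $\Delta_{13}=\vartheta_{13}-\vartheta_{12}\vartheta_{23}$, $\Delta_{23}=\vartheta_{23}-\vartheta_{12}\vartheta_{13}$.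 Then every $z\in\mathbb R^N_+$ with $\operatorname{supp}(z)=\mathcal S$ is recovered from $y=Az$ via constrained matching pursuit on $\mathbb R^N_+$ if and only if all of the following hold: (i) $A_{\bullet\mathcal S}$ has full column rank; (ii) $\|(A_{\bullet\mathcal S}^TA_{\bullet\mathcal S}u)_+\|_\infty>\|(A_{\bullet\mathcal S^c}^TA_{\bullet\mathcal S}u)_+\|_\infty$ for all $u\in\mathbb R^3_{++}$; (iii) for each $\mathcal J\in\{\{1\},\{2\},\{3\}\}$, $\|(M/M_{\mathcal J\mathcal J}\,v)_+\|_\infty>\|(A_{\bullet\mathcal S^c}^T[I-A_{\bullet\mathcal J}A_{\bullet\mathcal J}^T]A_{\bullet\mathcal S\setminus\mathcal J}\,v)_+\|_\infty$ for all $v\in\mathbb R^2_{++}$; (iv) the following three implications hold: $$1-\vartheta_{12}^2>\min(\Delta_{13},\Delta_{23})\ \Longrightarrow\ \det M>\max_{i\in\mathcal S^c}\big(\vartheta_{i3}(1-\vartheta_{12}^2)-\vartheta_{i1}\Delta_{13}-\vartheta_{i2}\Delta_{23}\big)_+,$$ $$1-\vartheta_{13}^2>\min(\Delta_{12},\Delta_{23})\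 \Longrightarrow\ \det M>\max_{i\in\mathcal S^c}\big(\vartheta_{i2}(1-\vartheta_{13}^2)-\vartheta_{i1}\Delta_{12}-\vartheta_{i3}\Delta_{23}\big)_+,$$ $$1-\vartheta_{23}^2>\min(\Delta_{12},\Delta_{13})\ \Longrightarrow\ \det M>\max_{i\in\mathcal S^c}\big(\vartheta_{i1}(1-\vartheta_{23}^2)-\vartheta_{i2}\Delta_{12}-\vartheta_{i3}\Delta_{13}\big)_+.$$ -/

import Mathlib

noncomputable section

open scoped Matrix

namespace CMP

/-- The squared Euclidean norm of a vector of `ℝᵐ`. -/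
def sqNorm {m : ℕ} (v : Fin m → ℝ) : ℝ := ‖WithLp.toLp 2 v‖ ^ 2

/-- `A` has unit columns with respect to the Euclidean norm. -/
def UnitColumns {m N : ℕ} (A : Matrix (Fin m) (Fin N) ℝ) : Prop :=
  ∀ i, ‖WithLp.toLp 2 (A.col i)‖ = 1

/-- The value `min_t ‖y - A (x + t e_j)‖²` subject to `x + t e_j ∈ P`. The infimum is a minimum
when `P` is closed, `x ∈ P` and the `j`-th column of `A` is nonzero. -/
def coordMin {m N : ℕ} (A : Matrix (Fin m) (Fin N) ℝ) (P : Set (Fin N → ℝ))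
    (y : Fin m → ℝ) (x : Fin N → ℝ) (j : Fin N) : ℝ :=
  sInf ((fun t : ℝ => sqNorm (y - A *ᵥ (x + t • Pi.single j 1))) ''
    {t : ℝ | x + t • Pi.single j 1 ∈ P})

/-- The set of all minimizers of `‖A w - y‖²` over `w ∈ P` with `supp w ⊆ J`. -/
def restrictedArgmin {m N : ℕ} (A : Matrix (Fin m) (Fin N) ℝ) (P : Set (Fin N → ℝ))
    (y : Fin m → ℝ) (J : Finset (Fin N)) : Set (Fin N → ℝ) :=
  {w | w ∈ P ∧ Function.support w ⊆ ↑J ∧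
    ∀ w' ∈ P, Function.support w' ⊆ ↑J → sqNorm (A *ᵥ w - y) ≤ sqNorm (A *ᵥ w' - y)}

/-- `(x k, j k, J k)` is a sequence generated by constrained matching pursuit for the data
`A`, `P`, `y`; ties among minimizers are broken arbitrarily. The entry `j 0` plays no role. -/
structure IsSequence {m N : ℕ} (A : Matrix (Fin m) (Fin N) ℝ) (P : Set (Fin N → ℝ))
    (y : Fin m → ℝ) (x : ℕ → Fin N → ℝ) (j : ℕ → Fin N) (J : ℕ → Finset (Fin N)) : Prop where
  x_zero : x 0 = 0
  J_zero : J 0 = ∅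
  j_succ : ∀ k i, coordMin A P y (x k) (j (k + 1)) ≤ coordMin A P y (x k) i
  J_succ : ∀ k, J (k + 1) = insert (j (k + 1)) (J k)
  x_succ : ∀ k, x (k + 1) ∈ restrictedArgmin A P y (J (k + 1))

/-- Exact support recovery of `z` from `y = A z`: every generated sequence reaches `supp z`. -/
def ExactSupportRecovery {m N : ℕ} (A : Matrix (Fin m) (Fin N) ℝ) (P : Set (Fin N → ℝ))
    (z : Fin N → ℝ) : Prop :=
  ∀ x j J, IsSequence A P (A *ᵥ z) x j J → ∃ s, (J s : Set (Fin N)) = Function.support z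

/-- Exact vector recovery of `z` from `y = A z`: exact support recovery holds and, whenever
`J s = supp z` along a generated sequence, the restricted problem has `x s = z` as its
unique solution. -/
def ExactVectorRecovery {m N : ℕ} (A : Matrix (Fin m) (Fin N) ℝ) (P : Set (Fin N → ℝ))
    (z : Fin N → ℝ) : Prop :=
  ExactSupportRecovery A P z ∧
    ∀ x j J, IsSequence A P (A *ᵥ z) x j J →
      ∀ s, (J s : Set (Fin N)) = Function.support z →
        x s = z ∧ restrictedArgmin A P (A *ᵥ z) (J s) = {z}

/-- The nonnegative orthant of `ℝᴺ`. -/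
def nonnegOrthant (N : ℕ) : Set (Fin N → ℝ) := {x | ∀ i, 0 ≤ x i}

/-- The submatrix of `A` with columns `c k`, `k ∈ κ`. -/
def colSub {m N : ℕ} {κ : Type*} (A : Matrix (Fin m) (Fin N) ℝ) (c : κ → Fin N) :
    Matrix (Fin m) κ ℝ :=
  A.submatrix id c

/-- The Schur complement `M / M_{JJ}`, indexed by the complement of `J`. -/
def schurComplement {ι : Type*} [Fintype ι] [DecidableEq ι] (M : Matrix ι ι ℝ) (J : Finset ι) :
    Matrix {i // i ∉ J} {i // i ∉ J} ℝ :=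
  M.toBlock (· ∉ J) (· ∉ J) -
    M.toBlock (· ∉ J) (· ∈ J) * (M.toBlock (· ∈ J) (· ∈ J))⁻¹ * M.toBlock (· ∈ J) (· ∉ J)

/-- The first three indices: `idx hN 0`, `idx hN 1`, `idx hN 2` are the column indices
`1`, `2`, `3` of the usual numbering. -/
def idx {N : ℕ} (hN : 3 ≤ N) : Fin 3 → Fin N := Fin.castLE hN

/-- The index set `S = {1, 2, 3}` (usual numbering). -/
def suppS {N : ℕ} (hN : 3 ≤ N) : Finset (Fin N) := {idx hN 0, idx hN 1, idx hN 2}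

/-- The submatrix `A_S`; its columns are indexed by `Fin 3`. -/
def matS {m N : ℕ} (hN : 3 ≤ N) (A : Matrix (Fin m) (Fin N) ℝ) : Matrix (Fin m) (Fin 3) ℝ :=
  colSub A (idx hN)

/-- The submatrix `A_{Sᶜ}`. -/
def matSc {m N : ℕ} (hN : 3 ≤ N) (A : Matrix (Fin m) (Fin N) ℝ) :
    Matrix (Fin m) {j // j ∉ suppS hN} ℝ :=
  colSub A Subtype.val

/-- The matrix `M = A_Sᵀ A_S`. -/
def matM {m N : ℕ} (hN : 3 ≤ N) (A : Matrix (Fin m) (Fin N) ℝ) : Matrix (Fin 3) (Fin 3) ℝ :=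
  (matS hN A)ᵀ * matS hN A

/-- The submatrix `A_J` for `J ⊆ S`. -/
def matJ {m N : ℕ} (hN : 3 ≤ N) (A : Matrix (Fin m) (Fin N) ℝ) (J : Finset (Fin 3)) :
    Matrix (Fin m) {i // i ∈ J} ℝ :=
  colSub A (fun i => idx hN i)

/-- The submatrix `A_{S \ J}` for `J ⊆ S`. -/
def matSdiff {m N : ℕ} (hN : 3 ≤ N) (A : Matrix (Fin m) (Fin N) ℝ) (J : Finset (Fin 3)) :
    Matrix (Fin m) {i // i ∉ J} ℝ :=
  colSub A (fun i => idx hN i)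

/-- The inner product `ϑ_{ij}` of the columns `i` and `j` of `A`. -/
def theta {m N : ℕ} (A : Matrix (Fin m) (Fin N) ℝ) (i j : Fin N) : ℝ := A.col i ⬝ᵥ A.col j

/-- `Δ₁₂ = ϑ₁₂ - ϑ₁₃ ϑ₂₃`. -/
def Delta12 {m N : ℕ} (hN : 3 ≤ N) (A : Matrix (Fin m) (Fin N) ℝ) : ℝ :=
  theta A (idx hN 0) (idx hN 1) - theta A (idx hN 0) (idx hN 2) * theta A (idx hN 1) (idx hN 2)

/-- `Δ₁₃ = ϑ₁₃ - ϑ₁₂ ϑ₂₃`. -/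
def Delta13 {m N : ℕ} (hN : 3 ≤ N) (A : Matrix (Fin m) (Fin N) ℝ) : ℝ :=
  theta A (idx hN 0) (idx hN 2) - theta A (idx hN 0) (idx hN 1) * theta A (idx hN 1) (idx hN 2)

/-- `Δ₂₃ = ϑ₂₃ - ϑ₁₂ ϑ₁₃`. -/
def Delta23 {m N : ℕ} (hN : 3 ≤ N) (A : Matrix (Fin m) (Fin N) ℝ) : ℝ :=
  theta A (idx hN 1) (idx hN 2) - theta A (idx hN 0) (idx hN 1) * theta A (idx hN 0) (idx hN 2)

end CMP

end

noncomputable section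

open scoped Matrix

namespace CMP

/-! ### Existence of nonnegative least squares solutions -/

/-! At a restricted minimizer `x` with residual `r`, one coordinate step along column `i` lowers the
squared error by exactly the square of the positive part of `⟨A_i, r⟩` (`coordMin_eq`). The method
therefore selects a column maximizing this positive part. Columns of the current index set have
correlation at most zero. As long as the residual is nonzero, some column of the support of `z` has
positive correlation (`exists_corr_pos`). So the support is recovered exactly when, at every
reachable state with a proper subset of it, the maximal correlation is attained only inside the
support; this is `MaxInRange`.

For three columns with weights `u` there are three kinds of states. Initially the correlations are
`gram u`, which gives (ii). After selecting `a` they are `schurGram a u`, which does not depend on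
`u a`; this gives (iii). After `a` and then `b`, either the weight of `a` drops to zero and the
correlations are `schurGram b u`, already covered by (iii), or they are a positive multiple of
`pairGram a b c`, which is free of `u` and gives (iv) (`corr_of_mem_pair`). The premise in (iv) says
that one of the two orders of `a`, `b` can occur: `lt_of_schurGram_le` shows that it is necessary
for that order, and `pairGram_lt` realizes the order by weights large on `b` and then larger still
on `a`.

Necessity also requires that a bad finite prefix extend to an infinite sequence. This rests on the
existence of nonnegative least squares solutions, that is, on the closedness of finitely generated
cones. -/

/-- The nonnegative vectors supported on `J`. -/
def orthantFace {N : ℕ} (J : Finset (Fin N)) : Set (Fin N → ℝ) :=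
  {w | (∀ i, 0 ≤ w i) ∧ ∀ i ∉ J, w i = 0}

/-- The ratio test of Carathéodory's theorem: moving along `-d`, stop at the first coordinate with
`d i > 0` that reaches zero. Coordinates with `d i ≤ 0` cannot decrease. -/
lemma exists_mem_orthantFace_erase {N : ℕ} {J : Finset (Fin N)} {w d : Fin N → ℝ}
    (hw : w ∈ orthantFace J) (hd : ∀ i ∉ J, d i = 0) (hpos : ∃ i, 0 < d i) :
    ∃ j ∈ J, ∃ t : ℝ, w - t • d ∈ orthantFace (J.erase j) := by
  obtain ⟨i₀, hi₀⟩ := hpos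
  obtain ⟨j, hj, hmin⟩ := (Finset.univ.filter fun i => 0 < d i).exists_min_image
    (fun i => w i / d i) ⟨i₀, by simpa using hi₀⟩
  have hdj : 0 < d j := by simpa using hj
  refine ⟨j, by_contra fun h => hdj.ne' (hd j h), w j / d j, fun i => ?_, fun i hi => ?_⟩
  · simp only [Pi.sub_apply, Pi.smul_apply, smul_eq_mul, sub_nonneg]
    rcases le_or_gt (d i) 0 with h | h
    · exact (mul_nonpos_of_nonneg_of_nonpos (div_nonneg (hw.1 j) hdj.le) h).trans (hw.1 i)
    · exact (le_div_iff₀ h).1 (hmin i (by simpa using h))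
  · rcases eq_or_ne i j with rfl | hij
    · simp [hdj.ne']
    · have : i ∉ J := fun h => hi (Finset.mem_erase.2 ⟨hij, h⟩)
      simp [hw.2 i this, hd i this]

/-- If `f` is injective on the coordinate subspace of `J`, it is a closed embedding there. Otherwise
a kernel vector moves every point of the face to a smaller face without changing its image, so the
image is a finite union of images closed by induction. -/
lemma isClosed_image_orthantFace {N : ℕ} {E : Type*} [NormedAddCommGroup E] [NormedSpace ℝ E]
    (f : (Fin N → ℝ) →ₗ[ℝ] E) (J : Finset (Fin N)) : IsClosed (f '' orthantFace J) := by
  induction J using Finset.strongInduction with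
  | H J ih =>
    by_cases hinj : ∀ d : Fin N → ℝ, (∀ i ∉ J, d i = 0) → f d = 0 → d = 0
    · let V : Submodule ℝ (Fin N → ℝ) :=
        { carrier := {w | ∀ i ∉ J, w i = 0}
          add_mem' := fun {a b} ha hb i hi => by simp [ha i hi, hb i hi]
          zero_mem' := fun i _ => rfl
          smul_mem' := fun c a ha i hi => by simp [ha i hi] }
      have hker : LinearMap.ker (f.domRestrict V) = ⊥ := by
        rw [LinearMap.ker_eq_bot']
        exact fun d hd => Subtype.ext (hinj d d.2 hd)
      have hcl : IsClosed {w : V | ∀ i, 0 ≤ (w : Fin N → ℝ) i} := by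
        simp only [Set.ofPred_forall]
        exact isClosed_iInter fun i =>
          isClosed_le continuous_const ((continuous_apply i).comp continuous_subtype_val)
      have := (LinearMap.isClosedEmbedding_of_injective hker).isClosedMap _ hcl
      convert this using 1
      ext y
      constructor
      · rintro ⟨w, hw, rfl⟩
        exact ⟨⟨w, hw.2⟩, hw.1, rfl⟩
      · rintro ⟨w, hw, rfl⟩
        exact ⟨w, ⟨hw, w.2⟩, rfl⟩
    · push Not at hinj
      obtain ⟨d, hdJ, hfd, hd⟩ := hinj
      obtain ⟨d, hdJ, hfd, hpos⟩ :
          ∃ d : Fin N → ℝ, (∀ i ∉ J, d i = 0) ∧ f d = 0 ∧ ∃ i, 0 < d i := by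
        obtain ⟨i, hi⟩ := Function.ne_iff.1 hd
        rcases lt_or_gt_of_ne hi with h | h
        · exact ⟨-d, fun i hi => by simp [hdJ i hi], by simp [hfd], i, by simpa using h⟩
        · exact ⟨d, hdJ, hfd, i, h⟩
      have : f '' orthantFace J = ⋃ j ∈ J, f '' orthantFace (J.erase j) := by
        ext y
        simp only [Set.mem_iUnion]
        constructor
        · rintro ⟨w, hw, rfl⟩
          obtain ⟨j, hj, t, h⟩ := exists_mem_orthantFace_erase hw hdJ hpos
          exact ⟨j, hj, _, h, by simp [hfd]⟩
        · rintro ⟨j, hj, w, hw, rfl⟩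
          exact ⟨w, ⟨hw.1, fun i hi => hw.2 i fun h => hi (Finset.mem_of_mem_erase h)⟩, rfl⟩
      rw [this]
      exact J.finite_toSet.isClosed_biUnion fun j hj => ih _ (Finset.erase_ssubset hj)

lemma restrictedArgmin_nonempty {m N : ℕ} (A : Matrix (Fin m) (Fin N) ℝ) (y : Fin m → ℝ)
    (J : Finset (Fin N)) : (restrictedArgmin A (nonnegOrthant N) y J).Nonempty := by
  let f : (Fin N → ℝ) →ₗ[ℝ] EuclideanSpace ℝ (Fin m) :=
    (WithLp.linearEquiv 2 ℝ (Fin m → ℝ)).symm.toLinearMap ∘ₗ A.mulVecLin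
  have hf : ∀ w, sqNorm (A *ᵥ w - y) = dist (WithLp.toLp 2 y) (f w) ^ 2 := fun w => by
    rw [dist_comm, dist_eq_norm]; rfl
  obtain ⟨_, ⟨w, hw, rfl⟩, hmin⟩ := (isClosed_image_orthantFace f J).exists_infDist_eq_dist
    ⟨f 0, 0, ⟨fun _ => le_rfl, fun _ _ => rfl⟩, rfl⟩ (WithLp.toLp 2 y)
  refine ⟨w, hw.1, Function.support_subset_iff'.2 hw.2, fun w' hw' hs => ?_⟩
  rw [hf, hf, ← hmin]
  have hmem : f w' ∈ f '' orthantFace J :=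
    ⟨w', ⟨hw', Function.support_subset_iff'.1 hs⟩, rfl⟩
  exact pow_le_pow_left₀ Metric.infDist_nonneg (Metric.infDist_le_dist_of_mem hmem) 2

/-! ### Generated sequences -/

/-- The iterates `(x, J)` that constrained matching pursuit can produce. -/
inductive Reachable {m N : ℕ} (A : Matrix (Fin m) (Fin N) ℝ) (P : Set (Fin N → ℝ))
    (y : Fin m → ℝ) : (Fin N → ℝ) → Finset (Fin N) → Prop
  | zero : Reachable A P y 0 ∅
  | step {x x' : Fin N → ℝ} {J : Finset (Fin N)} {j : Fin N} (h : Reachable A P y x J)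
      (hj : ∀ i, coordMin A P y x j ≤ coordMin A P y x i)
      (hx' : x' ∈ restrictedArgmin A P y (insert j J)) : Reachable A P y x' (insert j J)

/-- `(x k, j k, J k)` follows the update rules of constrained matching pursuit from an arbitrary
initial state. -/
def IsTail {m N : ℕ} (A : Matrix (Fin m) (Fin N) ℝ) (P : Set (Fin N → ℝ))
    (y : Fin m → ℝ) (x : ℕ → Fin N → ℝ) (j : ℕ → Fin N) (J : ℕ → Finset (Fin N)) : Prop :=
  ∀ k, (∀ i, coordMin A P y (x k) (j (k + 1)) ≤ coordMin A P y (x k) i) ∧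
    J (k + 1) = insert (j (k + 1)) (J k) ∧ x (k + 1) ∈ restrictedArgmin A P y (J (k + 1))

lemma exists_isTail {m N : ℕ} [NeZero N] (A : Matrix (Fin m) (Fin N) ℝ)
    (y : Fin m → ℝ) (x₀ : Fin N → ℝ) (J₀ : Finset (Fin N)) :
    ∃ x j J, IsTail A (nonnegOrthant N) y x j J ∧ x 0 = x₀ ∧ J 0 = J₀ := by
  choose sel hsel using fun x => Finite.exists_min (coordMin A (nonnegOrthant N) y x)
  choose sol hsol using restrictedArgmin_nonempty A y
  let next : (Fin N → ℝ) × Finset (Fin N) → (Fin N → ℝ) × Finset (Fin N) :=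
    fun p => (sol (insert (sel p.1) p.2), insert (sel p.1) p.2)
  let st : ℕ → (Fin N → ℝ) × Finset (Fin N) := fun k => next^[k] (x₀, J₀)
  have hst : ∀ k, st (k + 1) = next (st k) := fun k => Function.iterate_succ_apply' _ _ _
  -- The selection at index `k + 1` is made from state `k`; truncated subtraction only affects the
  -- irrelevant entry at `0`.
  refine ⟨fun k => (st k).1, fun k => sel (st (k - 1)).1, fun k => (st k).2, fun k => ?_, rfl, rfl⟩
  simp only [Nat.add_sub_cancel, hst, next]
  exact ⟨hsel _, trivial, hsol _⟩

/-- By induction on the derivation, its last step is prepended to the tail. In the shifted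
selections `j₁` appears at positions `0` and `1`: the former is a dummy, and `j 0` is discarded. -/
lemma Reachable.exists_isSequence {m N : ℕ} {A : Matrix (Fin m) (Fin N) ℝ}
    {P : Set (Fin N → ℝ)} {y : Fin m → ℝ} {x₀ : Fin N → ℝ} {J₀ : Finset (Fin N)}
    (h : Reachable A P y x₀ J₀) {x : ℕ → Fin N → ℝ} {j : ℕ → Fin N} {J : ℕ → Finset (Fin N)}
    (ht : IsTail A P y x j J) (hx : x 0 = x₀) (hJ : J 0 = J₀) :
    ∃ x' j' J', IsSequence A P y x' j' J' ∧ ∃ k, ∀ n, J' (k + n) = J n := by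
  induction h generalizing x j J with
  | zero =>
    exact ⟨x, j, J, ⟨hx, hJ, fun k => (ht k).1, fun k => (ht k).2.1, fun k => (ht k).2.2⟩,
      0, fun n => by rw [zero_add]⟩
  | @step x₁ x' J₁ j₁ _ hj hx' ih =>
    obtain ⟨X, j', J', hs, k, hk⟩ := ih (x := fun n => n.casesOn x₁ x)
      (j := fun n => n.casesOn j₁ fun n => n.casesOn j₁ fun n => j (n + 1))
      (J := fun n => n.casesOn J₁ J) (fun n => by
        cases n with
        | zero => exact ⟨hj, hJ, by simpa only [hx, hJ] using hx'⟩
        | succ n => exact ht n) rfl rfl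
    exact ⟨X, j', J', hs, k + 1, fun n => by rw [add_assoc, add_comm 1]; exact hk (n + 1)⟩

lemma Reachable.exists_isSequence_mem {m N : ℕ} [NeZero N] {A : Matrix (Fin m) (Fin N) ℝ}
    {y : Fin m → ℝ} {x₀ : Fin N → ℝ} {J₀ : Finset (Fin N)}
    (h : Reachable A (nonnegOrthant N) y x₀ J₀) :
    ∃ x j J, IsSequence A (nonnegOrthant N) y x j J ∧ ∃ k, J k = J₀ := by
  obtain ⟨x, j, J, ht, hx, hJ⟩ := exists_isTail A y x₀ J₀
  obtain ⟨x', j', J', hs, k, hk⟩ := h.exists_isSequence ht hx hJ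
  exact ⟨x', j', J', hs, k, by rw [← hJ, ← hk 0, add_zero]⟩

lemma IsSequence.monotone {m N : ℕ} {A : Matrix (Fin m) (Fin N) ℝ} {P : Set (Fin N → ℝ)}
    {y : Fin m → ℝ} {x : ℕ → Fin N → ℝ} {j : ℕ → Fin N} {J : ℕ → Finset (Fin N)}
    (h : IsSequence A P y x j J) : Monotone J :=
  monotone_nat_of_le_succ fun k => by rw [h.J_succ]; exact Finset.subset_insert _ _

/-- If every generated sequence reaches the support `S` of `z`, then an index outside `S` is never
selected before `S` is exhausted. -/
lemma Reachable.mem_of_exactSupportRecovery {m N : ℕ} [NeZero N] {A : Matrix (Fin m) (Fin N) ℝ}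
    {z x : Fin N → ℝ} {J S : Finset (Fin N)} {j : Fin N}
    (hz : ExactSupportRecovery A (nonnegOrthant N) z) (hS : Function.support z = (S : Set (Fin N)))
    (h : Reachable A (nonnegOrthant N) (A *ᵥ z) x J) (hJ : ¬ S ⊆ J)
    (hj : ∀ i, coordMin A (nonnegOrthant N) (A *ᵥ z) x j ≤
      coordMin A (nonnegOrthant N) (A *ᵥ z) x i) : j ∈ S := by
  by_contra hjS
  obtain ⟨x', hx'⟩ := restrictedArgmin_nonempty A (A *ᵥ z) (insert j J)
  obtain ⟨X, j', J', hs, k, hk⟩ := (h.step hj hx').exists_isSequence_mem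
  obtain ⟨s, hs'⟩ := hz _ _ _ hs
  rw [hS, Finset.coe_inj] at hs'
  -- The index sets increase. After time `k` they contain `j ∉ S`; before it they lie in `insert j
  -- J`, which does not contain `S`.
  rcases le_total k s with hks | hks
  · have := hs.monotone hks
    rw [hs', hk] at this
    exact hjS (this (Finset.mem_insert_self _ _))
  · have := hs.monotone hks
    rw [hs', hk] at this
    exact hJ fun i hi => (Finset.mem_insert.1 (this hi)).resolve_left fun h => hjS (h ▸ hi)

/-! ### Optimality conditions and the selection rule -/

section Optimality

variable {m N : ℕ} {A : Matrix (Fin m) (Fin N) ℝ} {y : Fin m → ℝ} {x : Fin N → ℝ}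
  {J : Finset (Fin N)} {i j : Fin N}

lemma sqNorm_eq_dotProduct (v : Fin m → ℝ) : sqNorm v = v ⬝ᵥ v := by
  rw [sqNorm, EuclideanSpace.real_norm_sq_eq]
  simp only [dotProduct, sq]

lemma sqNorm_sub_comm (v w : Fin m → ℝ) : sqNorm (v - w) = sqNorm (w - v) := by
  simp only [sqNorm, WithLp.toLp_sub, norm_sub_rev]

lemma sqNorm_eq_zero {v : Fin m → ℝ} : sqNorm v = 0 ↔ v = 0 := by
  rw [sqNorm_eq_dotProduct, dotProduct_self_eq_zero]

lemma sqNorm_nonneg (v : Fin m → ℝ) : 0 ≤ sqNorm v := sq_nonneg _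

lemma UnitColumns.theta_self (hA : UnitColumns A) (i : Fin N) : theta A i i = 1 := by
  have := sqNorm_eq_dotProduct (A.col i)
  rw [sqNorm, hA i, one_pow] at this
  exact this.symm

lemma theta_comm (A : Matrix (Fin m) (Fin N) ℝ) (i j : Fin N) : theta A i j = theta A j i :=
  dotProduct_comm _ _

/-- The correlation of the `i`-th column of `A` with the residual `y - A x`. -/
def corr (A : Matrix (Fin m) (Fin N) ℝ) (y : Fin m → ℝ) (x : Fin N → ℝ) (i : Fin N) : ℝ :=
  A.col i ⬝ᵥ (y - A *ᵥ x)

lemma sqNorm_residual_add_single (hA : UnitColumns A) (t : ℝ) :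
    sqNorm (y - A *ᵥ (x + t • Pi.single i 1)) =
      sqNorm (y - A *ᵥ x) - 2 * t * corr A y x i + t ^ 2 := by
  have h : y - A *ᵥ (x + t • Pi.single i 1) = (y - A *ᵥ x) - t • A.col i := by
    rw [Matrix.mulVec_add, Matrix.mulVec_smul, Matrix.mulVec_single_one, sub_sub]
  have h1 : A.col i ⬝ᵥ A.col i = 1 := hA.theta_self i
  rw [h, corr]
  generalize y - A *ᵥ x = r
  simp only [sqNorm_eq_dotProduct, sub_dotProduct, dotProduct_sub, smul_dotProduct,
    dotProduct_smul, h1, dotProduct_comm r (A.col i), smul_eq_mul]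
  ring

lemma add_smul_single_mem_nonnegOrthant (hx : x ∈ nonnegOrthant N) {t : ℝ} :
    x + t • Pi.single i 1 ∈ nonnegOrthant N ↔ 0 ≤ x i + t := by
  constructor
  · intro h
    simpa using h i
  · intro h k
    rcases eq_or_ne k i with rfl | hk
    · simpa using h
    · simpa [hk] using hx k

lemma eq_zero_of_mem_restrictedArgmin {P : Set (Fin N → ℝ)} (hx : x ∈ restrictedArgmin A P y J)
    (hi : i ∉ J) : x i = 0 :=
  Function.support_subset_iff'.1 hx.2.1 i (by simpa using hi)

/-- Optimality tested on single-coordinate perturbations; the sign and complementary slackness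
conditions below follow by choosing `t`. -/
lemma two_mul_corr_le (hA : UnitColumns A) (hx : x ∈ restrictedArgmin A (nonnegOrthant N) y J)
    (hi : i ∈ J) {t : ℝ} (ht : 0 ≤ x i + t) : 2 * t * corr A y x i ≤ t ^ 2 := by
  have h := hx.2.2 (x + t • Pi.single i 1) ((add_smul_single_mem_nonnegOrthant hx.1).2 ht)
    (Function.support_subset_iff'.2 fun k hk => by
      have hki : k ≠ i := fun h => hk (by simpa [h] using hi)
      simp [eq_zero_of_mem_restrictedArgmin hx hk, hki])
  rw [sqNorm_sub_comm, sqNorm_sub_comm _ y, sqNorm_residual_add_single hA] at h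
  linarith

lemma corr_nonpos (hA : UnitColumns A) (hx : x ∈ restrictedArgmin A (nonnegOrthant N) y J)
    (hi : i ∈ J) : corr A y x i ≤ 0 := by
  by_contra! h
  have := two_mul_corr_le hA hx hi (t := corr A y x i) (add_nonneg (hx.1 i) h.le)
  nlinarith

lemma corr_eq_zero (hA : UnitColumns A) (hx : x ∈ restrictedArgmin A (nonnegOrthant N) y J)
    (hi : i ∈ J) (hxi : x i ≠ 0) : corr A y x i = 0 := by
  have hpos : 0 < x i := lt_of_le_of_ne (hx.1 i) hxi.symm
  refine (corr_nonpos hA hx hi).antisymm ?_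
  by_contra! h
  -- The test step is the unconstrained minimizer `corr`, clipped at `-x i` to stay feasible.
  have ht : max (corr A y x i) (-x i) < 0 := max_lt h (by linarith)
  have h1 := le_max_left (corr A y x i) (-x i)
  have h2 := le_max_right (corr A y x i) (-x i)
  have := two_mul_corr_le hA hx hi (t := max (corr A y x i) (-x i)) (by linarith)
  nlinarith

lemma zero_mem_restrictedArgmin_empty : (0 : Fin N → ℝ) ∈
    restrictedArgmin A (nonnegOrthant N) y ∅ :=
  ⟨fun _ => le_rfl, by simp, fun w' _ h => by
    rw [Finset.coe_empty, Set.subset_empty_iff, Function.support_eq_empty_iff] at h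
    rw [h]⟩

/-- Outside `J` the constraint is `t ≥ 0`, so the best step is the clipped correlation. Inside `J`
no feasible step improves on an already optimal `x`, and the correlation is nonpositive. -/
lemma coordMin_eq (hA : UnitColumns A) (hx : x ∈ restrictedArgmin A (nonnegOrthant N) y J)
    (i : Fin N) :
    coordMin A (nonnegOrthant N) y x i = sqNorm (y - A *ᵥ x) - (max (corr A y x i) 0) ^ 2 := by
  refine IsLeast.csInf_eq ⟨⟨max (corr A y x i) 0, ?_, ?_⟩, ?_⟩
  · exact (add_smul_single_mem_nonnegOrthant hx.1).2 (add_nonneg (hx.1 i) (le_max_right _ _))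
  · simp only [sqNorm_residual_add_single hA]
    rcases max_cases (corr A y x i) 0 with ⟨h, _⟩ | ⟨h, _⟩ <;> rw [h] <;> ring
  · rintro _ ⟨t, ht, rfl⟩
    replace ht := (add_smul_single_mem_nonnegOrthant hx.1).1 ht
    simp only [sqNorm_residual_add_single hA]
    by_cases hi : i ∈ J
    · have h := two_mul_corr_le hA hx hi ht
      rw [max_eq_right (corr_nonpos hA hx hi)]
      linarith
    · rw [eq_zero_of_mem_restrictedArgmin hx hi, zero_add] at ht
      rcases max_cases (corr A y x i) 0 with ⟨h, _⟩ | ⟨h, _⟩ <;> rw [h] <;>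
        nlinarith [sq_nonneg (t - corr A y x i)]

lemma coordMin_le_iff (hA : UnitColumns A) (hx : x ∈ restrictedArgmin A (nonnegOrthant N) y J) :
    coordMin A (nonnegOrthant N) y x j ≤ coordMin A (nonnegOrthant N) y x i ↔
      max (corr A y x i) 0 ≤ max (corr A y x j) 0 := by
  rw [coordMin_eq hA hx, coordMin_eq hA hx, sub_le_sub_iff_left,
    pow_le_pow_iff_left₀ (le_max_right _ _) (le_max_right _ _) two_ne_zero]

lemma Reachable.mem_restrictedArgmin
    (h : Reachable A (nonnegOrthant N) y x J) : x ∈ restrictedArgmin A (nonnegOrthant N) y J := by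
  cases h with
  | zero => exact zero_mem_restrictedArgmin_empty
  | step _ _ h => exact h

lemma IsSequence.mem_restrictedArgmin {x : ℕ → Fin N → ℝ} {j : ℕ → Fin N}
    {J : ℕ → Finset (Fin N)} (h : IsSequence A (nonnegOrthant N) y x j J) (k : ℕ) :
    x k ∈ restrictedArgmin A (nonnegOrthant N) y (J k) := by
  cases k with
  | zero => rw [h.x_zero, h.J_zero]; exact zero_mem_restrictedArgmin_empty
  | succ k => exact h.x_succ k

/-- The residual of a restricted least squares solution is positively correlated with some column
occurring in a nonnegative representation of `y`, unless it vanishes. -/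
lemma exists_corr_pos {z : Fin N → ℝ} (hz : z ∈ nonnegOrthant N)
    (hx : x ∈ restrictedArgmin A (nonnegOrthant N) (A *ᵥ z) J) (hne : A *ᵥ z - A *ᵥ x ≠ 0) :
    ∃ i, z i ≠ 0 ∧ 0 < corr A (A *ᵥ z) x i := by
  set r := A *ᵥ z - A *ᵥ x with hr
  have hsum : ∀ w : Fin N → ℝ, r ⬝ᵥ (A *ᵥ w) = ∑ i, w i * corr A (A *ᵥ z) x i := fun w => by
    rw [Matrix.dotProduct_mulVec, dotProduct_comm]
    refine Finset.sum_congr rfl fun i _ => ?_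
    rw [corr, dotProduct_comm]; rfl
  -- Shrinking `x` to `(1 - t) • x` is feasible and cannot improve the error; the first-order term
  -- in `t` gives the sign.
  have hrx : 0 ≤ r ⬝ᵥ (A *ᵥ x) := by
    have key : ∀ t : ℝ, 0 ≤ t → t ≤ 1 →
        0 ≤ 2 * t * (r ⬝ᵥ (A *ᵥ x)) + t ^ 2 * sqNorm (A *ᵥ x) := fun t h0 h1 => by
      have h := hx.2.2 ((1 - t) • x)
        (fun i => mul_nonneg (by linarith) (hx.1 i))
        ((Function.support_const_smul_subset _ _).trans hx.2.1)
      have he : A *ᵥ z - A *ᵥ ((1 - t) • x) = r + t • A *ᵥ x := by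
        rw [Matrix.mulVec_smul, hr]; module
      rw [sqNorm_sub_comm, sqNorm_sub_comm _ (A *ᵥ z), he, ← hr] at h
      simp only [sqNorm_eq_dotProduct, dotProduct_add, add_dotProduct, smul_dotProduct,
        dotProduct_smul, smul_eq_mul, dotProduct_comm (A *ᵥ x) r] at h ⊢
      linarith
    by_contra! hneg
    have hn := sqNorm_nonneg (A *ᵥ x)
    set c := r ⬝ᵥ (A *ᵥ x)
    set q := sqNorm (A *ᵥ x)
    -- For `c < 0`, the step `-c / (q - c + 1)` lies in `(0, 1]` and makes `t * q < -c`, so the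
    -- linear term dominates.
    have hd : 0 < q - c + 1 := by linarith
    have ht1 : -c / (q - c + 1) ≤ 1 := by rw [div_le_one hd]; linarith
    have ht0 : 0 < -c / (q - c + 1) := div_pos (by linarith) hd
    have h := key _ ht0.le ht1
    set t := -c / (q - c + 1)
    have hmul : t * (q - c + 1) = -c := div_mul_cancel₀ _ hd.ne'
    have : 0 ≤ 2 * c + t * q := by
      by_contra! h'
      nlinarith
    nlinarith
  have hpos : 0 < r ⬝ᵥ (A *ᵥ z) := by
    have h1 : 0 < r ⬝ᵥ r := by
      rw [← sqNorm_eq_dotProduct]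
      exact lt_of_le_of_ne (sqNorm_nonneg _) fun h => hne (sqNorm_eq_zero.1 h.symm)
    have h2 : r ⬝ᵥ r = r ⬝ᵥ (A *ᵥ z) - r ⬝ᵥ (A *ᵥ x) := by rw [← dotProduct_sub]
    linarith
  rw [hsum] at hpos
  obtain ⟨i, -, hi⟩ := Finset.exists_lt_of_sum_lt (f := fun _ => (0 : ℝ)) (by simpa using hpos)
  exact ⟨i, fun h => by simp [h] at hi, pos_of_mul_pos_right hi (hz i)⟩

end Optimality

/-! ### Three-element supports -/

section ThreeElementSupport

variable {m N : ℕ} {A : Matrix (Fin m) (Fin N) ℝ} {e : Fin 3 → Fin N} {x : Fin N → ℝ}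
  {J : Finset (Fin N)} {u : Fin 3 → ℝ} {a b c : Fin 3}

/-- The vector of `ℝᴺ` with entries `u l` at the positions `e l` and `0` elsewhere. -/
def embed (e : Fin 3 → Fin N) (u : Fin 3 → ℝ) : Fin N → ℝ := Function.extend e u 0

/-- The correlations of all columns of `A` with `∑ l, u l • A.col (e l)`. -/
def gram (A : Matrix (Fin m) (Fin N) ℝ) (e : Fin 3 → Fin N) (u : Fin 3 → ℝ) (i : Fin N) : ℝ :=
  ∑ l, theta A i (e l) * u l

/-- The correlations of all columns of `A` with the projection of `∑ l, u l • A.col (e l)` onto the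
orthogonal complement of the unit vector `A.col (e a)`. -/
def schurGram (A : Matrix (Fin m) (Fin N) ℝ) (e : Fin 3 → Fin N) (a : Fin 3) (u : Fin 3 → ℝ)
    (i : Fin N) : ℝ :=
  gram A e u i - theta A i (e a) * gram A e u (e a)

/-- Up to a positive factor, the correlation of the `i`-th column of `A` with the projection of
`A.col (e c)` onto the orthogonal complement of `A.col (e a)` and `A.col (e b)`. -/
def pairGram (A : Matrix (Fin m) (Fin N) ℝ) (e : Fin 3 → Fin N) (a b c : Fin 3) (i : Fin N) : ℝ :=
  theta A i (e c) * (1 - theta A (e a) (e b) ^ 2)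
    - theta A i (e a) * (theta A (e a) (e c) - theta A (e a) (e b) * theta A (e b) (e c))
    - theta A i (e b) * (theta A (e b) (e c) - theta A (e a) (e b) * theta A (e a) (e c))

/-- The positive part of `g` attains its maximum only on the range of `e`. -/
def MaxInRange (e : Fin 3 → Fin N) (g : Fin N → ℝ) : Prop :=
  ∃ l, 0 < g (e l) ∧ ∀ i, i ∉ Set.range e → g i < g (e l)

lemma embed_apply (he : e.Injective) (u : Fin 3 → ℝ) (l : Fin 3) : embed e u (e l) = u l :=
  he.extend_apply _ _ _

lemma embed_of_notMem {i : Fin N} (hi : i ∉ Set.range e) : embed e u i = 0 :=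
  Function.extend_apply' _ _ _ hi

lemma support_embed (he : e.Injective) (hu : ∀ l, 0 < u l) :
    Function.support (embed e u) = Set.range e := by
  ext i
  by_cases hi : i ∈ Set.range e
  · obtain ⟨l, rfl⟩ := hi
    simp [embed_apply he, (hu l).ne']
  · simp [embed_of_notMem hi, hi]

lemma embed_mem_nonnegOrthant (he : e.Injective) (hu : ∀ l, 0 < u l) :
    embed e u ∈ nonnegOrthant N := fun i => by
  by_cases hi : i ∈ Set.range e
  · obtain ⟨l, rfl⟩ := hi
    rw [embed_apply he]
    exact (hu l).le
  · rw [embed_of_notMem hi]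

lemma eq_embed (he : e.Injective) (hx : Function.support x ⊆ Set.range e) :
    x = embed e (x ∘ e) := by
  ext i
  by_cases hi : i ∈ Set.range e
  · obtain ⟨l, rfl⟩ := hi
    rw [embed_apply he]; rfl
  · rw [embed_of_notMem hi]
    exact Function.support_subset_iff'.1 hx i hi

lemma mulVec_embed (he : e.Injective) (u : Fin 3 → ℝ) :
    A *ᵥ embed e u = colSub A e *ᵥ u := by
  ext k
  simp only [Matrix.mulVec, dotProduct, colSub, Matrix.submatrix_apply, id]
  refine (Finset.sum_of_injOn e he.injOn (by simp) (fun i _ hi => ?_) fun l _ => ?_).symm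
  · rw [embed_of_notMem (by simpa using hi), mul_zero]
  · rw [embed_apply he]

lemma col_dotProduct_colSub_mulVec (i : Fin N) (u : Fin 3 → ℝ) :
    A.col i ⬝ᵥ (colSub A e *ᵥ u) = gram A e u i := by
  simp only [gram, theta, dotProduct, Matrix.mulVec, colSub, Finset.mul_sum, Finset.sum_mul]
  rw [Finset.sum_comm]
  exact Finset.sum_congr rfl fun l _ => Finset.sum_congr rfl fun k _ => (mul_assoc _ _ _).symm

lemma residual_eq (he : e.Injective) (hx : Function.support x ⊆ Set.range e) :
    A *ᵥ embed e u - A *ᵥ x = colSub A e *ᵥ (u - x ∘ e) := by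
  conv_lhs => rw [eq_embed he hx]
  rw [mulVec_embed he, mulVec_embed he, Matrix.mulVec_sub]

lemma gram_sub (u v : Fin 3 → ℝ) (i : Fin N) : gram A e (u - v) i = gram A e u i - gram A e v i := by
  simp [gram, mul_sub, Finset.sum_sub_distrib]

lemma corr_eq_gram_sub (he : e.Injective) (hx : Function.support x ⊆ Set.range e) (i : Fin N) :
    corr A (A *ᵥ embed e u) x i = gram A e u i - gram A e (x ∘ e) i := by
  rw [corr, residual_eq he hx, col_dotProduct_colSub_mulVec, gram_sub]

lemma sum_eq_of_ne (hab : a ≠ b) (hac : a ≠ c) (hbc : b ≠ c) (f : Fin 3 → ℝ) :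
    ∑ l, f l = f a + f b + f c := by
  have : ∀ a b c : Fin 3, a ≠ b → a ≠ c → b ≠ c → (Finset.univ : Finset (Fin 3)) = {a, b, c} := by
    decide
  rw [this a b c hab hac hbc, Finset.sum_insert (by simp [hab, hac]), Finset.sum_pair hbc, add_assoc]

lemma gram_add_single (u : Fin 3 → ℝ) (s : ℝ) (l : Fin 3) (i : Fin N) :
    gram A e (u + Pi.single l s) i = gram A e u i + s * theta A i (e l) := by
  simp [gram, mul_add, Finset.sum_add_distrib, Pi.single_apply, mul_comm]

lemma schurGram_add_single (u : Fin 3 → ℝ) (s : ℝ) (l : Fin 3) (i : Fin N) :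
    schurGram A e a (u + Pi.single l s) i =
      schurGram A e a u i + s * (theta A i (e l) - theta A i (e a) * theta A (e a) (e l)) := by
  simp only [schurGram, gram_add_single]
  ring

lemma schurGram_self (hA : UnitColumns A) : schurGram A e a u (e a) = 0 := by
  rw [schurGram, hA.theta_self, one_mul, sub_self]

lemma sum_mul_gram (u : Fin 3 → ℝ) :
    ∑ l, u l * gram A e u (e l) = sqNorm (colSub A e *ᵥ u) := by
  rw [sqNorm_eq_dotProduct, Matrix.dotProduct_mulVec, dotProduct_comm]
  refine Finset.sum_congr rfl fun l _ => ?_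
  rw [← col_dotProduct_colSub_mulVec, dotProduct_comm (A.col (e l))]
  rfl

lemma sum_mul_gram_pos (hI : Function.Injective (colSub A e).mulVec) (hu : u ≠ 0) :
    0 < ∑ l, u l * gram A e u (e l) := by
  rw [sum_mul_gram]
  refine lt_of_le_of_ne (sqNorm_nonneg _) fun h => hu (hI ?_)
  rw [sqNorm_eq_zero.1 h.symm, Matrix.mulVec_zero]

/-- The quadratic form of the Gram matrix is positive. -/
lemma quadratic_pos (hA : UnitColumns A) (hI : Function.Injective (colSub A e).mulVec)
    (hab : a ≠ b) (hac : a ≠ c) (hbc : b ≠ c) (p q r : ℝ) (h : q ≠ 0) :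
    0 < p ^ 2 + q ^ 2 + r ^ 2 + 2 * p * q * theta A (e a) (e b) + 2 * p * r * theta A (e a) (e c)
      + 2 * q * r * theta A (e b) (e c) := by
  let w : Fin 3 → ℝ := fun l => if l = a then p else if l = b then q else r
  have wa : w a = p := by simp [w]
  have wb : w b = q := by simp [w, hab.symm]
  have wc : w c = r := by simp [w, hac.symm, hbc.symm]
  have := sum_mul_gram_pos hI (u := w) fun h0 => h (by rw [← wb, h0]; rfl)
  simp only [gram, sum_eq_of_ne hab hac hbc, wa, wb, wc, hA.theta_self, theta_comm A (e b) (e a),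
    theta_comm A (e c) (e a), theta_comm A (e c) (e b)] at this
  linarith

lemma exists_third (hab : a ≠ b) : ∃ c : Fin 3, a ≠ c ∧ b ≠ c := by
  revert a b; decide

lemma theta_sq_lt_one (hA : UnitColumns A) (hI : Function.Injective (colSub A e).mulVec)
    (hab : a ≠ b) : 0 < 1 - theta A (e a) (e b) ^ 2 := by
  obtain ⟨c, hac, hbc⟩ := exists_third hab
  have := quadratic_pos hA hI hab hac hbc (-theta A (e a) (e b)) 1 0 one_ne_zero
  linarith

lemma theta_lt_one (hA : UnitColumns A) (hI : Function.Injective (colSub A e).mulVec)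
    (hab : a ≠ b) : theta A (e a) (e b) < 1 := by
  nlinarith [theta_sq_lt_one hA hI hab]

/-! ### The three selection steps -/

lemma coordMin_le_of_corr_le (hA : UnitColumns A) {y : Fin m → ℝ} {j : Fin N}
    (hx : x ∈ restrictedArgmin A (nonnegOrthant N) y J)
    (hj : ∀ i, corr A y x i ≤ corr A y x j) (i : Fin N) :
    coordMin A (nonnegOrthant N) y x j ≤ coordMin A (nonnegOrthant N) y x i :=
  (coordMin_le_iff hA hx).2 (max_le_max (hj i) le_rfl)

/-- A positive maximum cannot be attained on `J`, where correlations are nonpositive; hence every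
admissible selection is a new index in the range of `e`. -/
lemma MaxInRange.exists_of_coordMin_le (hA : UnitColumns A) {y : Fin m → ℝ} {j : Fin N}
    (h : MaxInRange e (corr A y x)) (hx : x ∈ restrictedArgmin A (nonnegOrthant N) y J)
    (hj : ∀ i, coordMin A (nonnegOrthant N) y x j ≤ coordMin A (nonnegOrthant N) y x i) :
    ∃ l, e l = j ∧ j ∉ J ∧ 0 < corr A y x j ∧ ∀ i, corr A y x i ≤ corr A y x j := by
  obtain ⟨l, hl, hmax⟩ := h
  have hmono : ∀ i, max (corr A y x i) 0 ≤ max (corr A y x j) 0 := fun i =>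
    (coordMin_le_iff hA hx).1 (hj i)
  have hjpos : 0 < corr A y x j := by
    by_contra! hneg
    have := (le_max_left _ _).trans (hmono (e l))
    rw [max_eq_right hneg] at this
    linarith
  have hjmax : ∀ i, corr A y x i ≤ corr A y x j := fun i => by
    have := (le_max_left _ _).trans (hmono i)
    rwa [max_eq_left hjpos.le] at this
  have hjr : j ∈ Set.range e := by
    by_contra h
    exact absurd (hjmax (e l)) (not_le.2 (hmax j h))
  obtain ⟨k, rfl⟩ := hjr
  exact ⟨k, rfl, fun hJ => absurd (corr_nonpos hA hx hJ) (not_le.2 hjpos), hjpos, hjmax⟩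

lemma MaxInRange.le_of_forall_le {g : Fin N → ℝ} (h : MaxInRange e g)
    (ha : ∀ l, g (e l) ≤ g (e a)) (i : Fin N) : g i ≤ g (e a) := by
  by_cases hi : i ∈ Set.range e
  · obtain ⟨l, rfl⟩ := hi
    exact ha l
  · obtain ⟨l, -, hl⟩ := h
    exact (hl i hi).le.trans (ha l)

/-- Positivity of `gram` at `e a` forces a nonzero coefficient there, so the residual is orthogonal
to that unit column and the coefficient equals `gram A e u (e a)`. -/
lemma corr_of_mem_singleton (hA : UnitColumns A) (he : e.Injective) (hpos : 0 < gram A e u (e a))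
    (hx : x ∈ restrictedArgmin A (nonnegOrthant N) (A *ᵥ embed e u) {e a}) (i : Fin N) :
    corr A (A *ᵥ embed e u) x i = schurGram A e a u i := by
  have hsupp : Function.support x ⊆ Set.range e := hx.2.1.trans (by simp)
  have hform : ∀ i, corr A (A *ᵥ embed e u) x i = gram A e u i - theta A i (e a) * x (e a) := by
    intro i
    rw [corr_eq_gram_sub he hsupp]
    congr 1
    refine Finset.sum_eq_single a (fun l _ hl => ?_) (by simp)
    have : x (e l) = 0 := eq_zero_of_mem_restrictedArgmin hx (by simpa using he.ne hl)
    simp [this]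
  have hle := corr_nonpos hA hx (i := e a) (by simp)
  rw [hform, hA.theta_self] at hle
  have h0 := corr_eq_zero hA hx (i := e a) (by simp) (by intro h; rw [h] at hle; linarith)
  rw [hform, hA.theta_self] at h0
  rw [hform, schurGram]
  congr 2
  linarith

/-- After the selection of `a` and then `b`, either the solution is supported on `b` alone, or the
residual is orthogonal to both columns. -/
lemma corr_of_mem_pair (hA : UnitColumns A) (he : e.Injective) (hab : a ≠ b) (hac : a ≠ c)
    (hbc : b ≠ c) (hpos : 0 < gram A e u (e a))
    (hpos' : 0 < schurGram A e a u (e b))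
    (hx : x ∈ restrictedArgmin A (nonnegOrthant N) (A *ᵥ embed e u) {e a, e b}) :
    (∀ i, corr A (A *ᵥ embed e u) x i = schurGram A e b u i) ∨
      (corr A (A *ᵥ embed e u) x (e a) = 0 ∧ corr A (A *ᵥ embed e u) x (e b) = 0 ∧
        ∀ i, (1 - theta A (e a) (e b) ^ 2) * corr A (A *ᵥ embed e u) x i =
          u c * pairGram A e a b c i) := by
  have hsupp : Function.support x ⊆ Set.range e := hx.2.1.trans (by simp [Set.insert_subset_iff])
  have hc : x (e c) = 0 := eq_zero_of_mem_restrictedArgmin hx (by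
    simp [he.eq_iff, hac.symm, hbc.symm])
  have hform : ∀ i, corr A (A *ᵥ embed e u) x i =
      gram A e u i - (theta A i (e a) * x (e a) + theta A i (e b) * x (e b)) := by
    intro i
    rw [corr_eq_gram_sub he hsupp, gram, gram, sum_eq_of_ne hab hac hbc, sum_eq_of_ne hab hac hbc]
    simp [hc]
  have hma : e a ∈ ({e a, e b} : Finset (Fin N)) := by simp
  have hmb : e b ∈ ({e a, e b} : Finset (Fin N)) := by simp
  have hlea := corr_nonpos hA hx hma
  have hleb := corr_nonpos hA hx hmb
  have hcomm := theta_comm A (e b) (e a)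
  -- If `b` were unused, `x` would be the solution for `a` alone, whose residual still has positive
  -- correlation with column `b`.
  have hb : x (e b) ≠ 0 := by
    intro hb
    rw [hform, hA.theta_self, hb, mul_zero, add_zero, one_mul] at hlea
    have ha := corr_eq_zero hA hx hma (by intro h; rw [h] at hlea; linarith)
    rw [hform, hA.theta_self, hb, mul_zero, add_zero, one_mul] at ha
    rw [hform, hb, mul_zero, add_zero, show x (e a) = gram A e u (e a) by linarith] at hleb
    rw [schurGram] at hpos'
    linarith
  have hb0 := corr_eq_zero hA hx hmb hb
  by_cases ha : x (e a) = 0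
  · left
    rw [hform, hA.theta_self, ha] at hb0
    intro i
    rw [hform, schurGram, ha, show gram A e u (e b) = x (e b) by linarith]
    ring
  · right
    have ha0 := corr_eq_zero hA hx hma ha
    refine ⟨ha0, hb0, fun i => ?_⟩
    simp only [hform, gram, sum_eq_of_ne hab hac hbc, hA.theta_self, hcomm] at ha0 hb0 ⊢
    rw [pairGram]
    -- The coefficients are the row `(ϑ_ia, ϑ_ib)` times the adjugate of the Gram matrix of columns
    -- `a` and `b`; this eliminates `x (e a)` and `x (e b)`.
    linear_combination (theta A i (e a) - theta A i (e b) * theta A (e a) (e b)) * ha0 +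
      (theta A i (e b) - theta A i (e a) * theta A (e a) (e b)) * hb0

lemma corr_zero (he : e.Injective) (u : Fin 3 → ℝ) :
    corr A (A *ᵥ embed e u) 0 = gram A e u := by
  ext i
  rw [corr_eq_gram_sub he (by simp)]
  simp [gram]

lemma range_eq_of_ne (e : Fin 3 → Fin N) (hab : a ≠ b) (hac : a ≠ c) (hbc : b ≠ c) :
    Set.range e = {e c, e b, e a} := by
  have : ∀ a b c : Fin 3, a ≠ b → a ≠ c → b ≠ c → ∀ l, l = a ∨ l = b ∨ l = c := by
    decide
  ext i
  constructor
  · rintro ⟨l, rfl⟩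
    rcases this a b c hab hac hbc l with rfl | rfl | rfl <;> simp
  · rintro (rfl | rfl | rfl) <;> exact ⟨_, rfl⟩

lemma residual_ne_zero (he : e.Injective) (hI : Function.Injective (colSub A e).mulVec)
    (hu : ∀ l, 0 < u l) (hx : Function.support x ⊆ Set.range e) {l : Fin 3} (hl : x (e l) = 0) :
    A *ᵥ embed e u - A *ᵥ x ≠ 0 := by
  rw [residual_eq he hx]
  intro h
  have h0 : u - x ∘ e = 0 := hI (by rw [h, Matrix.mulVec_zero])
  have := congrFun h0 l
  simp only [Pi.sub_apply, Function.comp_apply, hl, sub_zero, Pi.zero_apply] at this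
  exact (hu l).ne' this

lemma exists_corr_range_pos (he : e.Injective) (hI : Function.Injective (colSub A e).mulVec)
    (hu : ∀ l, 0 < u l) (hx : x ∈ restrictedArgmin A (nonnegOrthant N) (A *ᵥ embed e u) J)
    (hJ : (J : Set (Fin N)) ⊆ Set.range e) {l : Fin 3} (hl : e l ∉ J) :
    ∃ k, 0 < corr A (A *ᵥ embed e u) x (e k) := by
  obtain ⟨i, hi, hpos⟩ := exists_corr_pos (embed_mem_nonnegOrthant he hu) hx
    (residual_ne_zero he hI hu (hx.2.1.trans hJ) (eq_zero_of_mem_restrictedArgmin hx hl))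
  have : i ∈ Set.range e := by
    by_contra h
    exact hi (embed_of_notMem h)
  obtain ⟨k, rfl⟩ := this
  exact ⟨k, hpos⟩

/-! ### Sufficiency -/

/-- If `a` and then `b` are selected, then `1 - ϑ_ab² > ϑ_bc - ϑ_ab ϑ_ac`. -/
lemma lt_of_schurGram_le (hA : UnitColumns A) (hI : Function.Injective (colSub A e).mulVec)
    (hab : a ≠ b) (hac : a ≠ c) (hbc : b ≠ c) (hu : ∀ l, 0 < u l)
    (h : schurGram A e a u (e c) ≤ schurGram A e a u (e b)) :
    theta A (e b) (e c) - theta A (e a) (e b) * theta A (e a) (e c) <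
      1 - theta A (e a) (e b) ^ 2 := by
  -- This is the squared length of `A_b - A_c` projected orthogonally to `A_a`. It yields `(1 -
  -- ϑ_ab²) + (1 - ϑ_ac²) > 2 (ϑ_bc - ϑ_ab ϑ_ac)`, so at most one of the two diagonal terms can fail
  -- to exceed the off-diagonal one.
  have hq := quadratic_pos hA hI hab hac hbc (-(theta A (e a) (e b) - theta A (e a) (e c))) 1 (-1)
    one_ne_zero
  simp only [schurGram, gram, sum_eq_of_ne hab hac hbc, hA.theta_self, theta_comm A (e b) (e a),
    theta_comm A (e c) (e a), theta_comm A (e c) (e b)] at h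
  by_contra! hle
  have h1 := mul_nonneg (hu b).le (sub_nonneg.2 hle)
  have h2 : 0 < u c * ((1 - theta A (e a) (e c) ^ 2) -
      (theta A (e b) (e c) - theta A (e a) (e b) * theta A (e a) (e c))) :=
    mul_pos (hu c) (by linarith)
  linarith

lemma restrictedArgmin_eq_singleton (he : e.Injective)
    (hI : Function.Injective (colSub A e).mulVec) (hu : ∀ l, 0 < u l)
    (hJ : (J : Set (Fin N)) = Set.range e) :
    restrictedArgmin A (nonnegOrthant N) (A *ᵥ embed e u) J = {embed e u} := by
  have hmem : embed e u ∈ nonnegOrthant N ∧ Function.support (embed e u) ⊆ (J : Set (Fin N)) :=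
    ⟨embed_mem_nonnegOrthant he hu, by rw [hJ, support_embed he hu]⟩
  have h0 : sqNorm (A *ᵥ embed e u - A *ᵥ embed e u) = 0 := by rw [sub_self, sqNorm_eq_zero]
  ext w
  simp only [Set.mem_singleton_iff]
  constructor
  · intro hw
    have h1 := hw.2.2 _ hmem.1 hmem.2
    rw [h0] at h1
    have h2 := sqNorm_eq_zero.1 (h1.antisymm (sqNorm_nonneg _))
    have hws : Function.support w ⊆ Set.range e := by rw [← hJ]; exact hw.2.1
    have h3 : A *ᵥ embed e u - A *ᵥ w = 0 := by rw [← neg_sub, h2, neg_zero]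
    rw [residual_eq he hws] at h3
    have h4 : u - w ∘ e = 0 := hI (by rw [h3, Matrix.mulVec_zero])
    rw [eq_embed he hws, ← sub_eq_zero.1 h4]
  · rintro rfl
    exact ⟨hmem.1, hmem.2, fun w' _ _ => by rw [h0]; exact sqNorm_nonneg _⟩

lemma exactVectorRecovery_embed (hA : UnitColumns A) (he : e.Injective)
    (hI : Function.Injective (colSub A e).mulVec)
    (hgram : ∀ u : Fin 3 → ℝ, (∀ l, 0 < u l) → MaxInRange e (gram A e u))
    (hschur : ∀ a, ∀ u : Fin 3 → ℝ, (∀ l, 0 < u l) → MaxInRange e (schurGram A e a u))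
    (hpair : ∀ a b c, a ≠ b → a ≠ c → b ≠ c →
      theta A (e b) (e c) - theta A (e a) (e b) * theta A (e a) (e c) <
        1 - theta A (e a) (e b) ^ 2 →
      ∀ i, i ∉ Set.range e → pairGram A e a b c i < pairGram A e a b c (e c))
    (hu : ∀ l, 0 < u l) : ExactVectorRecovery A (nonnegOrthant N) (embed e u) := by
  rw [ExactVectorRecovery, ExactSupportRecovery, support_embed he hu]
  refine ⟨fun x j J h => ⟨3, ?_⟩, fun x j J h s hs => ?_⟩
  · have hmax0 : MaxInRange e (corr A (A *ᵥ embed e u) (x 0)) := by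
      rw [h.x_zero, corr_zero he]
      exact hgram u hu
    obtain ⟨a, ha, -, hpos, -⟩ :=
      hmax0.exists_of_coordMin_le hA (h.mem_restrictedArgmin 0) (h.j_succ 0)
    rw [h.x_zero, corr_zero he, ← ha] at hpos
    have hJ1 : J 1 = {e a} := by rw [h.J_succ, h.J_zero, ← ha]; simp
    have hx1 := h.mem_restrictedArgmin 1
    rw [hJ1] at hx1
    have hcorr1 : corr A (A *ᵥ embed e u) (x 1) = schurGram A e a u :=
      funext (corr_of_mem_singleton hA he hpos hx1)
    have hmax1 : MaxInRange e (corr A (A *ᵥ embed e u) (x 1)) := by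
      rw [hcorr1]
      exact hschur a u hu
    obtain ⟨b, hb, hbJ, hposb, hbmax⟩ := hmax1.exists_of_coordMin_le hA hx1 (h.j_succ 1)
    rw [hcorr1, ← hb] at hposb
    simp only [hcorr1, ← hb] at hbmax
    have hab : a ≠ b := by
      rintro rfl
      exact hbJ (by simp [← hb])
    obtain ⟨c, hac, hbc⟩ := exists_third hab
    have hJ2 : J 2 = {e a, e b} := by
      rw [h.J_succ, hJ1, ← hb, Finset.pair_comm]
    have hx2 := h.mem_restrictedArgmin 2
    rw [hJ2] at hx2
    have hmax2 : MaxInRange e (corr A (A *ᵥ embed e u) (x 2)) := by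
      rcases corr_of_mem_pair hA he hab hac hbc hpos hposb hx2 with h' | ⟨ha0, hb0, h'⟩
      · rw [funext h']
        exact hschur b u hu
      · have hD := theta_sq_lt_one hA hI hab
        -- Some support column has positive correlation, and those of `a` and `b` vanish, so it is
        -- `c`; `hpair` then only has to compare `c` with columns outside the range.
        obtain ⟨k, hk⟩ := exists_corr_range_pos he hI hu hx2
          (by simp [Set.insert_subset_iff]) (l := c) (by simp [he.eq_iff, hac.symm, hbc.symm])
        have hkc : k = c := by
          have : e k ∈ Set.range e := ⟨k, rfl⟩
          rw [range_eq_of_ne e hab hac hbc] at this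
          rcases this with h1 | h1 | h1
          · exact he h1
          · rw [h1, hb0] at hk
            exact absurd hk (lt_irrefl _)
          · rw [h1, ha0] at hk
            exact absurd hk (lt_irrefl _)
        subst hkc
        refine ⟨k, hk, fun i hi => ?_⟩
        have h1 := hpair a b k hab hac hbc
          (lt_of_schurGram_le hA hI hab hac hbc hu (hbmax (e k))) i hi
        refine lt_of_mul_lt_mul_left ?_ hD.le
        rw [h', h']
        exact mul_lt_mul_of_pos_left h1 (hu k)
    obtain ⟨l, hl, hlJ, -, -⟩ := hmax2.exists_of_coordMin_le hA hx2 (h.j_succ 2)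
    have hal : a ≠ l := by
      rintro rfl
      exact hlJ (by simp [← hl])
    have hbl : b ≠ l := by
      rintro rfl
      exact hlJ (by simp [← hl])
    rw [range_eq_of_ne e hab hal hbl, h.J_succ, hJ2, ← hl, Finset.pair_comm]
    simp
  · have := restrictedArgmin_eq_singleton he hI hu hs
    refine ⟨?_, this⟩
    have hx := h.mem_restrictedArgmin s
    rw [this] at hx
    exact hx

/-! ### Necessity -/

/-- A kernel vector scaled to have entries below `1` in absolute value perturbs the all-ones vector
to another positive solution with the same image, against uniqueness. -/
lemma injective_of_exactVectorRecovery [NeZero N] (he : e.Injective)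
    (h : ExactVectorRecovery A (nonnegOrthant N) (embed e 1)) :
    Function.Injective (colSub A e).mulVec := by
  have h1 : ∀ l, (0 : ℝ) < (1 : Fin 3 → ℝ) l := fun _ => one_pos
  obtain ⟨X, j, J, hs, -⟩ := (Reachable.zero (A := A) (P := nonnegOrthant N)
    (y := A *ᵥ embed e 1)).exists_isSequence_mem
  obtain ⟨s, hJ⟩ := h.1 _ _ _ hs
  have huniq := (h.2 _ _ _ hs s hJ).2
  rw [support_embed he h1] at hJ
  refine (injective_iff_map_eq_zero (colSub A e).mulVecLin).2 fun d hd => ?_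
  have hd : colSub A e *ᵥ d = 0 := hd
  have hn : 0 < 1 + ‖d‖ := by positivity
  have hpos : ∀ l, 0 < ((1 : Fin 3 → ℝ) + (1 + ‖d‖)⁻¹ • d) l := fun l => by
    have h2 : -d l ≤ ‖d‖ := (neg_le_abs _).trans (norm_le_pi_norm d l)
    have h3 : (1 + ‖d‖)⁻¹ * (1 + ‖d‖) = 1 := inv_mul_cancel₀ hn.ne'
    have h4 := inv_pos.2 hn
    simp only [Pi.add_apply, Pi.one_apply, Pi.smul_apply, smul_eq_mul]
    nlinarith
  have hmem : embed e (1 + (1 + ‖d‖)⁻¹ • d) ∈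
      restrictedArgmin A (nonnegOrthant N) (A *ᵥ embed e 1) (J s) := by
    refine ⟨embed_mem_nonnegOrthant he hpos, by rw [hJ, support_embed he hpos], fun w' _ _ => ?_⟩
    rw [mulVec_embed he, mulVec_embed he, Matrix.mulVec_add, Matrix.mulVec_smul, hd, smul_zero,
      add_zero, sub_self, sqNorm_eq_zero.2 rfl]
    exact sqNorm_nonneg _
  rw [huniq, Set.mem_singleton_iff] at hmem
  ext l
  have := congrFun hmem (e l)
  rw [embed_apply he, embed_apply he] at this
  simpa [hn.ne'] using this

/-- Since ties are broken arbitrarily, recovery along every sequence forces strict inequality: an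
outside column tying with the maximum could be selected. -/
lemma Reachable.maxInRange [NeZero N] (hA : UnitColumns A) (he : e.Injective)
    (hI : Function.Injective (colSub A e).mulVec) (hu : ∀ l, 0 < u l)
    (hz : ExactSupportRecovery A (nonnegOrthant N) (embed e u))
    (h : Reachable A (nonnegOrthant N) (A *ᵥ embed e u) x J)
    (hJ : (J : Set (Fin N)) ⊆ Set.range e) {l : Fin 3} (hl : e l ∉ J) :
    MaxInRange e (corr A (A *ᵥ embed e u) x) := by
  have hx := h.mem_restrictedArgmin
  have hmem : ∀ j, (∀ i, corr A (A *ᵥ embed e u) x i ≤ corr A (A *ᵥ embed e u) x j) →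
      j ∈ Set.range e := fun j hj => by
    have hS : Function.support (embed e u) = ((Finset.univ.image e : Finset (Fin N)) :
        Set (Fin N)) := by
      rw [support_embed he hu]; simp
    have := h.mem_of_exactSupportRecovery hz hS
      (fun hsub => hl (hsub (by simp))) (coordMin_le_of_corr_le hA hx hj)
    simpa using this
  obtain ⟨k, hk⟩ := exists_corr_range_pos he hI hu hx hJ hl
  obtain ⟨a, ha⟩ := Finite.exists_max fun l => corr A (A *ᵥ embed e u) x (e l)
  refine ⟨a, hk.trans_le (ha k), fun i hi => ?_⟩
  by_contra! hle
  obtain ⟨j, hj⟩ := Finite.exists_max fun i => corr A (A *ᵥ embed e u) x i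
  obtain ⟨l, rfl⟩ := hmem j hj
  exact hi (hmem i fun i' => (hj i').trans ((ha l).trans hle))

lemma exists_reachable_singleton (hA : UnitColumns A) (he : e.Injective)
    (hgram : MaxInRange e (gram A e u)) (hpos : 0 < gram A e u (e a))
    (ha : ∀ l, gram A e u (e l) ≤ gram A e u (e a)) :
    ∃ x, Reachable A (nonnegOrthant N) (A *ᵥ embed e u) x {e a} ∧
      corr A (A *ᵥ embed e u) x = schurGram A e a u := by
  obtain ⟨x, hx⟩ := restrictedArgmin_nonempty A (A *ᵥ embed e u) {e a}
  refine ⟨x, ?_, funext (corr_of_mem_singleton hA he hpos hx)⟩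
  refine Reachable.zero.step (j := e a) (coordMin_le_of_corr_le hA
    zero_mem_restrictedArgmin_empty fun i => ?_) hx
  rw [corr_zero he]
  exact hgram.le_of_forall_le ha i

lemma eventually_lt_add_mul {k : ℝ} (hk : 0 < k) (p q : ℝ) :
    ∀ᶠ s : ℝ in Filter.atTop, p < q + s * k := by
  filter_upwards [(Filter.tendsto_id.atTop_mul_const hk).eventually_gt_atTop (p - q)] with s hs
  simp only [id] at hs
  linarith

/-- If the weight of `a` is large, then `a` is selected first. -/
lemma eventually_gram_le (hA : UnitColumns A) (hI : Function.Injective (colSub A e).mulVec)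
    (u : Fin 3 → ℝ) (a : Fin 3) :
    ∀ᶠ s : ℝ in Filter.atTop, 0 < gram A e (u + Pi.single a s) (e a) ∧
      ∀ l, gram A e (u + Pi.single a s) (e l) ≤ gram A e (u + Pi.single a s) (e a) := by
  refine Filter.Eventually.and ?_ (Filter.eventually_all.2 fun l => ?_)
  · filter_upwards [eventually_lt_add_mul one_pos 0 (gram A e u (e a))] with s hs
    rwa [gram_add_single, hA.theta_self]
  · rcases eq_or_ne l a with rfl | hl
    · exact Filter.Eventually.of_forall fun _ => le_rfl
    · filter_upwards [eventually_lt_add_mul (sub_pos.2 (theta_lt_one hA hI hl))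
        (gram A e u (e l)) (gram A e u (e a))] with s hs
      rw [gram_add_single, gram_add_single, hA.theta_self]
      linarith

lemma add_single_pos (hu : ∀ l, 0 < u l) {s : ℝ} (hs : 0 ≤ s) (a l : Fin 3) :
    0 < (u + Pi.single a s : Fin 3 → ℝ) l := by
  have : 0 ≤ (Pi.single a s : Fin 3 → ℝ) l := by
    rw [Pi.single_apply]; split_ifs <;> simp [hs]
  exact add_pos_of_pos_of_nonneg (hu l) this

lemma maxInRange_gram [NeZero N] (hA : UnitColumns A) (he : e.Injective)
    (hI : Function.Injective (colSub A e).mulVec) (hu : ∀ l, 0 < u l)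
    (hz : ExactSupportRecovery A (nonnegOrthant N) (embed e u)) : MaxInRange e (gram A e u) := by
  rw [← corr_zero he]
  exact Reachable.zero.maxInRange hA he hI hu hz (by simp) (l := 0) (by simp)

/-- Increasing `u a` leaves `schurGram A e a u` unchanged and eventually makes `a` a possible first
selection, so the state after `a` is reachable for a suitable choice of `u a`. -/
lemma maxInRange_schurGram [NeZero N] (hA : UnitColumns A) (he : e.Injective)
    (hI : Function.Injective (colSub A e).mulVec)
    (hrec : ∀ u : Fin 3 → ℝ, (∀ l, 0 < u l) →
      ExactSupportRecovery A (nonnegOrthant N) (embed e u))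
    (hu : ∀ l, 0 < u l) (a : Fin 3) : MaxInRange e (schurGram A e a u) := by
  obtain ⟨s, ⟨hpos, hmax⟩, hs⟩ :=
    ((eventually_gram_le hA hI u a).and (Filter.eventually_ge_atTop 0)).exists
  have hu' := add_single_pos hu hs a
  obtain ⟨x, hx, hcorr⟩ := exists_reachable_singleton hA he
    (maxInRange_gram hA he hI hu' (hrec _ hu')) hpos hmax
  have hschur : schurGram A e a (u + Pi.single a s) = schurGram A e a u := by
    ext i
    rw [schurGram_add_single, hA.theta_self, mul_one, sub_self, mul_zero, add_zero]
  rw [← hschur, ← hcorr]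
  obtain ⟨l, hl⟩ := exists_ne a
  exact hx.maxInRange hA he hI hu' (hrec _ hu') (by simp) (l := l) (by simpa using he.ne hl)

lemma pairGram_lt [NeZero N] (hA : UnitColumns A) (he : e.Injective)
    (hI : Function.Injective (colSub A e).mulVec)
    (hrec : ∀ u : Fin 3 → ℝ, (∀ l, 0 < u l) →
      ExactSupportRecovery A (nonnegOrthant N) (embed e u))
    (hab : a ≠ b) (hac : a ≠ c) (hbc : b ≠ c)
    (h : theta A (e b) (e c) - theta A (e a) (e b) * theta A (e a) (e c) <
      1 - theta A (e a) (e b) ^ 2) :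
    0 < pairGram A e a b c (e c) ∧
      ∀ i, i ∉ Set.range e → pairGram A e a b c i < pairGram A e a b c (e c) := by
  have hD := theta_sq_lt_one hA hI hab
  have hcomm := theta_comm A (e b) (e a)
  have hcomm' := theta_comm A (e c) (e a)
  have hcomm'' := theta_comm A (e c) (e b)
  -- A large weight `p` on `b` makes `b` beat `c` after `a`; the slope in `p` is positive by `h`.
  obtain ⟨p, ⟨hp1, hp2⟩, hp⟩ := (((eventually_lt_add_mul (sub_pos.2 h)
    (schurGram A e a 1 (e c)) (schurGram A e a 1 (e b))).and (eventually_lt_add_mul hD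
    0 (schurGram A e a 1 (e b)))).and (Filter.eventually_ge_atTop 0)).exists
  have hu₁ := add_single_pos (u := 1) (fun _ => one_pos) hp b
  set u₁ : Fin 3 → ℝ := 1 + Pi.single b p
  -- A large weight `s` on `a` makes `a` first without affecting the second selection. By `hs'` it
  -- also prevents `a` from dropping out of the two-column solution.
  obtain ⟨s, ⟨⟨hpos, hmax⟩, hs'⟩, hs⟩ := (((eventually_gram_le hA hI u₁ a).and
    (eventually_lt_add_mul hD 0 (schurGram A e b u₁ (e a)))).and
    (Filter.eventually_ge_atTop 0)).exists
  have hu := add_single_pos hu₁ hs a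
  set u : Fin 3 → ℝ := u₁ + Pi.single a s
  have hschur : schurGram A e a u = schurGram A e a u₁ := by
    ext i
    rw [schurGram_add_single, hA.theta_self, mul_one, sub_self, mul_zero, add_zero]
  have hb : 0 < schurGram A e a u (e b) := by
    rw [hschur, schurGram_add_single, hA.theta_self, hcomm]
    linarith
  have hcb : schurGram A e a u (e c) ≤ schurGram A e a u (e b) := by
    rw [hschur, schurGram_add_single, schurGram_add_single, hA.theta_self, hcomm, hcomm', hcomm'']
    linarith
  obtain ⟨x, hx, hcorr⟩ := exists_reachable_singleton hA he
    (maxInRange_gram hA he hI hu (hrec _ hu)) hpos hmax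
  obtain ⟨x', hx'⟩ := restrictedArgmin_nonempty A (A *ᵥ embed e u) {e b, e a}
  have hreach : Reachable A (nonnegOrthant N) (A *ᵥ embed e u) x' {e b, e a} := by
    refine hx.step (coordMin_le_of_corr_le hA hx.mem_restrictedArgmin ?_) hx'
    rw [hcorr]
    refine (maxInRange_schurGram hA he hI hrec hu a).le_of_forall_le fun l => ?_
    have : e l ∈ Set.range e := ⟨l, rfl⟩
    rw [range_eq_of_ne e hab hac hbc] at this
    rcases this with h1 | h1 | h1
    · rw [h1]; exact hcb
    · rw [h1]
    · rw [h1, schurGram_self hA]; exact hb.le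
  obtain ⟨l, hl, hlmax⟩ := hreach.maxInRange hA he hI hu (hrec _ hu)
    (by simp [Set.insert_subset_iff]) (l := c) (by simp [he.eq_iff, hac.symm, hbc.symm])
  rw [Finset.pair_comm] at hx'
  rcases corr_of_mem_pair hA he hab hac hbc hpos hb hx' with h' | ⟨ha0, hb0, h'⟩
  · have := corr_nonpos hA hx' (i := e a) (by simp)
    rw [h', schurGram_add_single, hA.theta_self, hcomm] at this
    exact absurd this (not_le.2 (by linarith))
  · have hlc : l = c := by
      have : e l ∈ Set.range e := ⟨l, rfl⟩
      rw [range_eq_of_ne e hab hac hbc] at this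
      rcases this with h1 | h1 | h1
      · exact he h1
      · rw [h1, hb0] at hl
        exact absurd hl (lt_irrefl _)
      · rw [h1, ha0] at hl
        exact absurd hl (lt_irrefl _)
    subst hlc
    have huc := hu l
    refine ⟨?_, fun i hi => ?_⟩
    · refine pos_of_mul_pos_right ?_ huc.le
      rw [← h']
      exact mul_pos hD hl
    · refine lt_of_mul_lt_mul_left ?_ huc.le
      rw [← h', ← h']
      exact mul_lt_mul_of_pos_left (hlmax i hi) hD

end ThreeElementSupport

/-! ### Translation of the matrix conditions -/

section Translation

variable {m N : ℕ} {A : Matrix (Fin m) (Fin N) ℝ}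

/-- The strict inequality forces the larger norm to be positive, so it is attained at a positive
entry and the positive parts can be dropped. Empty index types need no separate treatment. -/
lemma norm_posPart_lt_iff {ι κ : Type*} [Fintype ι] [Fintype κ] (f : ι → ℝ) (g : κ → ℝ) :
    ‖g⁺‖ < ‖f⁺‖ ↔ ∃ a, 0 < f a ∧ ∀ i, g i < f a := by
  constructor
  · intro h
    obtain ⟨a, ha⟩ : ∃ a, ‖g⁺‖ < ‖f⁺ a‖ := by
      by_contra! hle
      exact absurd h (not_lt.2 ((pi_norm_le_iff_of_nonneg (norm_nonneg _)).2 hle))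
    rw [Pi.posPart_apply, Real.norm_of_nonneg (posPart_nonneg _)] at ha
    have hpos : 0 < f a := posPart_pos_iff.1 ((norm_nonneg _).trans_lt ha)
    rw [posPart_of_nonneg hpos.le] at ha
    refine ⟨a, hpos, fun i => lt_of_le_of_lt ?_ ha⟩
    exact (le_posPart (g i)).trans ((Real.le_norm_self _).trans (norm_le_pi_norm g⁺ i))
  · rintro ⟨a, ha, hmax⟩
    have h1 : f a ≤ ‖f⁺‖ :=
      (le_posPart (f a)).trans ((Real.le_norm_self _).trans (norm_le_pi_norm f⁺ a))
    refine lt_of_lt_of_le ((pi_norm_lt_iff ha).2 fun i => ?_) h1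
    rw [Pi.posPart_apply, Real.norm_of_nonneg (posPart_nonneg _)]
    exact max_lt (hmax i) ha

lemma iSup_posPart_lt_iff {ι : Type*} [Finite ι] (f : ι → ℝ) (d : ℝ) :
    (⨆ i, (f i)⁺) < d ↔ 0 < d ∧ ∀ i, f i < d := by
  constructor
  · intro h
    refine ⟨(Real.iSup_nonneg fun i => posPart_nonneg (f i)).trans_lt h, fun i => ?_⟩
    exact (le_posPart (f i)).trans_lt
      ((le_ciSup (f := fun i => (f i)⁺) (Set.finite_range _).bddAbove i).trans_lt h)
  · rintro ⟨hd, h⟩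
    cases isEmpty_or_nonempty ι
    · rwa [Real.iSup_of_isEmpty]
    · obtain ⟨i, hi⟩ := exists_eq_ciSup_of_finite (f := fun i => (f i)⁺)
      rw [← hi]
      exact max_lt (h i) hd

lemma idx_injective (hN : 3 ≤ N) : Function.Injective (idx hN) := Fin.castLE_injective hN

lemma mem_suppS_iff (hN : 3 ≤ N) (i : Fin N) : i ∈ suppS hN ↔ i ∈ Set.range (idx hN) := by
  rw [range_eq_of_ne (idx hN) (a := 2) (b := 1) (c := 0) (by decide) (by decide) (by decide)]
  simp [suppS]

lemma gram_condition_iff (hN : 3 ≤ N) (u : Fin 3 → ℝ) :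
    ‖(((matSc hN A)ᵀ * matS hN A) *ᵥ u)⁺‖ < ‖(((matS hN A)ᵀ * matS hN A) *ᵥ u)⁺‖ ↔
      MaxInRange (idx hN) (gram A (idx hN) u) := by
  rw [norm_posPart_lt_iff]
  refine exists_congr fun l => and_congr Iff.rfl ?_
  rw [Subtype.forall]
  refine forall_congr' fun i => ?_
  exact ⟨fun h hi => h (mt (mem_suppS_iff hN i).1 hi), fun h hi => h (mt (mem_suppS_iff hN i).2 hi)⟩

lemma schurGram_eq_sum {e : Fin 3 → Fin N} {a : Fin 3} {u : Fin 3 → ℝ} (i : Fin N) :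
    schurGram A e a u i =
      ∑ l, (theta A i (e l) - theta A i (e a) * theta A (e a) (e l)) * u l := by
  simp only [schurGram, gram, Finset.mul_sum, ← Finset.sum_sub_distrib]
  exact Finset.sum_congr rfl fun l _ => by ring

/-- The term `l = a` may be omitted: its coefficient vanishes because column `a` has norm one. -/
lemma sum_ne_eq_schurGram (hA : UnitColumns A) {e : Fin 3 → Fin N} {a : Fin 3} {u : Fin 3 → ℝ}
    (i : Fin N) :
    ∑ l : {l // l ∉ ({a} : Finset (Fin 3))},
      (theta A i (e l) - theta A i (e a) * theta A (e a) (e l)) * u l = schurGram A e a u i := by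
  rw [schurGram_eq_sum]
  refine Fintype.sum_of_injective Subtype.val Subtype.val_injective _ _ (fun l hl => ?_)
    fun _ => rfl
  have : l = a := by simpa using hl
  rw [this, hA.theta_self, mul_one, sub_self, zero_mul]

lemma sum_mem_singleton {a : Fin 3} (f : {l // l ∈ ({a} : Finset (Fin 3))} → ℝ) :
    ∑ l, f l = f ⟨a, Finset.mem_singleton_self a⟩ :=
  Fintype.sum_eq_single _ fun l hl =>
    absurd (Subtype.ext (Finset.mem_singleton.1 l.2)) hl

lemma schurComplement_apply (hN : 3 ≤ N) (hA : UnitColumns A) (a : Fin 3)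
    (i l : {i // i ∉ ({a} : Finset (Fin 3))}) :
    schurComplement (matM hN A) {a} i l = theta A (idx hN i) (idx hN l) -
      theta A (idx hN i) (idx hN a) * theta A (idx hN a) (idx hN l) := by
  have hone : (matM hN A).toBlock (· ∈ ({a} : Finset (Fin 3))) (· ∈ ({a} : Finset (Fin 3))) = 1 := by
    ext ⟨k, hk⟩ ⟨k', hk'⟩
    obtain rfl := Finset.mem_singleton.1 hk
    obtain rfl := Finset.mem_singleton.1 hk'
    rw [Matrix.one_apply_eq]
    exact hA.theta_self _
  rw [schurComplement, hone, inv_one, Matrix.mul_one, Matrix.sub_apply, Matrix.mul_apply,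
    sum_mem_singleton]
  rfl

lemma projected_apply (hN : 3 ≤ N) (a : Fin 3)
    (i : {j // j ∉ suppS hN}) (l : {i // i ∉ ({a} : Finset (Fin 3))}) :
    ((matSc hN A)ᵀ * (1 - matJ hN A {a} * (matJ hN A {a})ᵀ) * matSdiff hN A {a} :
        Matrix _ _ ℝ) i l =
      theta A i (idx hN l) - theta A i (idx hN a) * theta A (idx hN a) (idx hN l) := by
  rw [Matrix.mul_sub, Matrix.sub_mul, Matrix.mul_one, ← Matrix.mul_assoc, Matrix.mul_assoc
    (_ * _), Matrix.sub_apply, Matrix.mul_apply (M := _ * _), sum_mem_singleton]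
  rfl

lemma schur_condition_iff (hN : 3 ≤ N) (hA : UnitColumns A) (a : Fin 3) (u : Fin 3 → ℝ) :
    ‖(((matSc hN A)ᵀ * (1 - matJ hN A {a} * (matJ hN A {a})ᵀ) * matSdiff hN A {a}) *ᵥ
        fun l : {l // l ∉ ({a} : Finset (Fin 3))} => u l)⁺‖ <
      ‖(schurComplement (matM hN A) {a} *ᵥ fun l => u l)⁺‖ ↔
      MaxInRange (idx hN) (schurGram A (idx hN) a u) := by
  rw [norm_posPart_lt_iff]
  simp only [Matrix.mulVec, dotProduct, schurComplement_apply hN hA, projected_apply,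
    sum_ne_eq_schurGram hA]
  rw [MaxInRange]
  simp only [Subtype.exists, Subtype.forall, mem_suppS_iff]
  -- The witness automatically differs from `a`, since `schurGram` vanishes at `e a`.
  refine exists_congr fun l => ⟨fun ⟨_, h⟩ => h, fun h => ⟨?_, h⟩⟩
  rw [Finset.mem_singleton]
  rintro rfl
  rw [schurGram_self hA] at h
  exact lt_irrefl _ h.1

lemma det_matM (hN : 3 ≤ N) (hA : UnitColumns A) :
    (matM hN A).det = 1 - theta A (idx hN 0) (idx hN 1) ^ 2 - theta A (idx hN 0) (idx hN 2) ^ 2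
      - theta A (idx hN 1) (idx hN 2) ^ 2 + 2 * theta A (idx hN 0) (idx hN 1) *
        theta A (idx hN 0) (idx hN 2) * theta A (idx hN 1) (idx hN 2) := by
  have h : ∀ i l, matM hN A i l = theta A (idx hN i) (idx hN l) := fun _ _ => rfl
  rw [Matrix.det_fin_three]
  simp only [h, hA.theta_self, theta_comm A (idx hN 1) (idx hN 0),
    theta_comm A (idx hN 2) (idx hN 0), theta_comm A (idx hN 2) (idx hN 1)]
  ring

/-- The condition on `pairGram` for the two orders in which `a` and `b` can be selected. -/
def PairCondition (A : Matrix (Fin m) (Fin N) ℝ) (e : Fin 3 → Fin N) (a b c : Fin 3) : Prop :=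
  theta A (e b) (e c) - theta A (e a) (e b) * theta A (e a) (e c) < 1 - theta A (e a) (e b) ^ 2 →
    0 < pairGram A e a b c (e c) ∧
      ∀ i, i ∉ Set.range e → pairGram A e a b c i < pairGram A e a b c (e c)

lemma pairGram_swap (e : Fin 3 → Fin N) (a b c : Fin 3) (i : Fin N) :
    pairGram A e b a c i = pairGram A e a b c i := by
  rw [pairGram, pairGram, theta_comm A (e b) (e a)]
  ring

/-- A bound on the minimum is a disjunction over the two selection orders, while `pairGram` is
symmetric in `a` and `b`; the implication thus splits into one condition per order. -/
lemma pairCondition_and_iff (hN : 3 ≤ N) {a b c : Fin 3} {d Δ₁ Δ₂ : ℝ}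
    (f : {j // j ∉ suppS hN} → ℝ)
    (hd : d = pairGram A (idx hN) a b c (idx hN c))
    (hf : ∀ i, f i = pairGram A (idx hN) a b c i)
    (h₁ : Δ₁ = theta A (idx hN a) (idx hN c) -
      theta A (idx hN a) (idx hN b) * theta A (idx hN b) (idx hN c))
    (h₂ : Δ₂ = theta A (idx hN b) (idx hN c) -
      theta A (idx hN a) (idx hN b) * theta A (idx hN a) (idx hN c)) :
    (min Δ₁ Δ₂ < 1 - theta A (idx hN a) (idx hN b) ^ 2 → ⨆ i, (f i)⁺ < d) ↔
      PairCondition A (idx hN) a b c ∧ PairCondition A (idx hN) b a c := by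
  rw [iSup_posPart_lt_iff, min_lt_iff, or_imp, and_comm, PairCondition, PairCondition, h₁, h₂, hd,
    Subtype.forall]
  simp only [hf, pairGram_swap (A := A) (idx hN) a b, theta_comm A (idx hN b) (idx hN a),
    mem_suppS_iff]

end Translation

end CMP

end

open scoped Matrix in
open CMP in
theorem mainTheorem3 {m N : ℕ} (hN : 3 ≤ N) (A : Matrix (Fin m) (Fin N) ℝ)
    (hA : UnitColumns A) :
    (∀ z ∈ nonnegOrthant N, Function.support z = (suppS hN : Set (Fin N)) →
        ExactVectorRecovery A (nonnegOrthant N) z) ↔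
      -- (i) full column rank
      LinearIndependent ℝ (matS hN A).col ∧
      -- (ii); `‖·‖` is the maximum norm on a finite product of copies of `ℝ`
      (∀ u : Fin 3 → ℝ, (∀ i, 0 < u i) →
        ‖(((matS hN A)ᵀ * matS hN A) *ᵥ u)⁺‖ > ‖(((matSc hN A)ᵀ * matS hN A) *ᵥ u)⁺‖) ∧
      -- (iii)
      (∀ J ∈ ({{0}, {1}, {2}} : Set (Finset (Fin 3))),
        ∀ v : {i // i ∉ J} → ℝ, (∀ i, 0 < v i) →
          ‖(schurComplement (matM hN A) J *ᵥ v)⁺‖ >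
            ‖(((matSc hN A)ᵀ * (1 - matJ hN A J * (matJ hN A J)ᵀ) * matSdiff hN A J) *ᵥ v)⁺‖) ∧
      -- (iv); the maximum over an empty index set is `0`
      ((1 - theta A (idx hN 0) (idx hN 1) ^ 2 > min (Delta13 hN A) (Delta23 hN A) →
          (matM hN A).det > ⨆ i : {j // j ∉ suppS hN},
            (theta A i (idx hN 2) * (1 - theta A (idx hN 0) (idx hN 1) ^ 2)
              - theta A i (idx hN 0) * Delta13 hN A - theta A i (idx hN 1) * Delta23 hN A)⁺) ∧
        (1 - theta A (idx hN 0) (idx hN 2) ^ 2 > min (Delta12 hN A) (Delta23 hN A) →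
          (matM hN A).det > ⨆ i : {j // j ∉ suppS hN},
            (theta A i (idx hN 1) * (1 - theta A (idx hN 0) (idx hN 2) ^ 2)
              - theta A i (idx hN 0) * Delta12 hN A - theta A i (idx hN 2) * Delta23 hN A)⁺) ∧
        (1 - theta A (idx hN 1) (idx hN 2) ^ 2 > min (Delta12 hN A) (Delta13 hN A) →
          (matM hN A).det > ⨆ i : {j // j ∉ suppS hN},
            (theta A i (idx hN 0) * (1 - theta A (idx hN 1) (idx hN 2) ^ 2)
              - theta A i (idx hN 1) * Delta12 hN A - theta A i (idx hN 2) * Delta13 hN A)⁺)) := by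
  have : NeZero N := ⟨by omega⟩
  have he := idx_injective hN
  have hS : (suppS hN : Set (Fin N)) = Set.range (idx hN) := Set.ext (mem_suppS_iff hN)
  have hdet := det_matM hN hA
  have c10 := theta_comm A (idx hN 1) (idx hN 0)
  have c20 := theta_comm A (idx hN 2) (idx hN 0)
  have c21 := theta_comm A (idx hN 2) (idx hN 1)
  have hleft : (∀ z ∈ nonnegOrthant N, Function.support z = (suppS hN : Set (Fin N)) →
      ExactVectorRecovery A (nonnegOrthant N) z) ↔ ∀ u : Fin 3 → ℝ, (∀ l, 0 < u l) →
        ExactVectorRecovery A (nonnegOrthant N) (embed (idx hN) u) := by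
    rw [hS]
    refine ⟨fun h u hu => h _ (embed_mem_nonnegOrthant he hu) (support_embed he hu),
      fun h z hz hs => ?_⟩
    rw [eq_embed he hs.subset]
    refine h _ fun l => lt_of_le_of_ne (hz _) fun h0 => ?_
    have : idx hN l ∈ Function.support z := hs ▸ ⟨l, rfl⟩
    exact this h0.symm
  have hrank : LinearIndependent ℝ (matS hN A).col ↔
      Function.Injective (colSub A (idx hN)).mulVec := Matrix.mulVec_injective_iff.symm
  have hschur : (∀ J ∈ ({{0}, {1}, {2}} : Set (Finset (Fin 3))),
      ∀ v : {i // i ∉ J} → ℝ, (∀ i, 0 < v i) → ‖(schurComplement (matM hN A) J *ᵥ v)⁺‖ >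
        ‖(((matSc hN A)ᵀ * (1 - matJ hN A J * (matJ hN A J)ᵀ) * matSdiff hN A J) *ᵥ v)⁺‖) ↔
      ∀ a, ∀ u : Fin 3 → ℝ, (∀ l, 0 < u l) →
        MaxInRange (idx hN) (schurGram A (idx hN) a u) := by
    have hJ : ∀ J : Finset (Fin 3), J ∈ ({{0}, {1}, {2}} : Set (Finset (Fin 3))) ↔ ∃ a, {a} = J :=
      fun J => by simp [Fin.exists_fin_succ, eq_comm]
    simp only [hJ, forall_exists_index, forall_apply_eq_imp_iff]
    refine forall_congr' fun a => ⟨fun h u hu => ?_, fun h v hv => ?_⟩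
    · exact (schur_condition_iff hN hA a u).1 (h _ fun l => hu l)
    -- Any positive value at `a` will do, because `schurGram` does not depend on it.
    · let u : Fin 3 → ℝ := fun l => if h : l ∉ ({a} : Finset (Fin 3)) then v ⟨l, h⟩ else 1
      have hv' : v = fun l : {l // l ∉ ({a} : Finset (Fin 3))} => u l :=
        funext fun l => by simp only [u, dif_pos l.2]
      have hu : ∀ l, 0 < u l := fun l => by
        by_cases hl : l ∉ ({a} : Finset (Fin 3))
        · simpa only [u, dif_pos hl] using hv _
        · simp only [u, dif_neg hl, one_pos]
      rw [hv']
      exact (schur_condition_iff hN hA a u).2 (h u hu)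
  rw [hleft, hrank, hschur]
  simp only [gt_iff_lt, gram_condition_iff]
  -- The determinant equals `pairGram` at its own third column, for each choice of that column. The
  -- three implications together cover all six orders.
  have h012 := pairCondition_and_iff (A := A) hN (a := 0) (b := 1) (c := 2)
    (d := (matM hN A).det) (Δ₁ := Delta13 hN A) (Δ₂ := Delta23 hN A)
    (fun i => theta A i (idx hN 2) * (1 - theta A (idx hN 0) (idx hN 1) ^ 2)
      - theta A i (idx hN 0) * Delta13 hN A - theta A i (idx hN 1) * Delta23 hN A)
    (by rw [hdet, pairGram, hA.theta_self, c20, c21]; ring) (fun _ => rfl) rfl rfl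
  have h021 := pairCondition_and_iff (A := A) hN (a := 0) (b := 2) (c := 1)
    (d := (matM hN A).det) (Δ₁ := Delta12 hN A) (Δ₂ := Delta23 hN A)
    (fun i => theta A i (idx hN 1) * (1 - theta A (idx hN 0) (idx hN 2) ^ 2)
      - theta A i (idx hN 0) * Delta12 hN A - theta A i (idx hN 2) * Delta23 hN A)
    (by rw [hdet, pairGram, hA.theta_self, c10, c21]; ring)
    (fun _ => by rw [pairGram, Delta12, Delta23, c21]; ring) (by rw [Delta12, c21])
    (by rw [Delta23, c21]; ring)
  have h120 := pairCondition_and_iff (A := A) hN (a := 1) (b := 2) (c := 0)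
    (d := (matM hN A).det) (Δ₁ := Delta12 hN A) (Δ₂ := Delta13 hN A)
    (fun i => theta A i (idx hN 0) * (1 - theta A (idx hN 1) (idx hN 2) ^ 2)
      - theta A i (idx hN 1) * Delta12 hN A - theta A i (idx hN 2) * Delta13 hN A)
    (by rw [hdet, pairGram, hA.theta_self, c10, c20]; ring)
    (fun _ => by rw [pairGram, Delta12, Delta13, c10, c20]; ring)
    (by rw [Delta12, c10, c20]; ring) (by rw [Delta13, c10, c20]; ring)
  rw [h012, h021, h120]
  constructor
  · intro h
    have hI := injective_of_exactVectorRecovery he (h 1 fun _ => one_pos)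
    have hrec := fun u hu => (h u hu).1
    have hpair : ∀ a b c : Fin 3, a ≠ b → a ≠ c → b ≠ c → PairCondition A (idx hN) a b c :=
      fun a b c hab hac hbc => pairGram_lt hA he hI hrec hab hac hbc
    refine ⟨hI, fun u hu => maxInRange_gram hA he hI hu (hrec u hu),
      fun a u hu => maxInRange_schurGram hA he hI hrec hu a, ⟨?_, ?_⟩, ⟨?_, ?_⟩, ?_, ?_⟩ <;>
    exact hpair _ _ _ (by decide) (by decide) (by decide)
  · rintro ⟨hI, hgram, hsch, ⟨h1, h2⟩, ⟨h3, h4⟩, h5, h6⟩ u hu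
    refine exactVectorRecovery_embed hA he hI hgram hsch (fun a b c hab hac hbc hlt => ?_) hu
    suffices hp : PairCondition A (idx hN) a b c from (hp hlt).2
    fin_cases a <;> fin_cases b <;> fin_cases c <;> first | contradiction | assumption
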